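/- Let $n\ge 1$ and $\ell\in\{1,\dots,n\}$. Let $\Omega\subset\mathbb R^n$ be a bounded domain that is star shaped with respect to an open ball $B\subset\Omega$, i.e. for every $y\in\Omega$ the convex hull of $B\cup\{y\}$ is contained in $\Omega$. Set $R=\operatorname{diam}(\Omega)$ and $\rho=\operatorname{diam}(B)$. Let $\theta\in C_0^\infty(B)$ satisfy $\int\theta\,dx=1$ and, for all multi-indices $\alpha$, $$\|\partial^\alpha\theta\|_{L^1}\le \frac{K_\alpha}{\rho^{|\alpha|}},\qquad \|\partial^\alpha\theta\|_{L^\infty}\le\frac{K_\alpha}{\rho^{n+|\alpha|}},$$ where the constants $K_\alpha=K(n,\alpha)$ are fixed once and for all, independently of $\Omega$ and $B$. For $m\in\{1,\dots,n\}$ and $f\in L^2(\mathbb R^n)$ with $\operatorname{supp} f\subset\overline\Omega$ let $$P_\ell f(x)=\int_0^1 s^{\ell-1}\int_{\mathbb R^n}\theta\Big(x+\frac{y-x}{1-s}\Big)\frac{x_m-y_m}{1-s}\,f(y)\,dy\,\frac{ds}{(1-s)^n}.$$ Then this double integral converges absolutely for almost every $x\in\Omega$, $P_\ell f\in H^1(\Omega)$,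 and $$|P_\ell f|_{H^1(\Omega)}=\Big(\sum_{j=1}^n\|\partial_j P_\ell f\|_{L^2(\Omega)}^2\Big)^{1/2}\le C\,\frac R\rho\,\kappa\,\|f\|_{L^2(\Omega)},$$ where $C=C(n,\ell)$ depends only on $n$ and $\ell$ (and on the fixed constants $K(n,\alpha)$), and 1. if $2\ell>n$, then $\kappa=1$; 2. if $2\ell=n-1$ or $2\ell=n$, then $$\kappa=1+\Big(\frac{|\Omega|}{|B|}\Big)^{\frac{n-2\ell}{2(n-\ell)}}\Big(\log\frac{|\Omega|}{|B|}\Big)^{\frac{n}{2(n-\ell)}};$$ 3. if $2\ell\le n-2$, then $$\kappa=1+\Big(\frac{|\Omega|}{|B|}\Big)^{\frac{n-2\ell}{2(n-\ell)}}\Big(\log\frac{|\Omega|}{|B|}\Big)^{\frac{n}{2(n-\ell-1)}}.$$ -/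

import Mathlib

open MeasureTheory
open scoped ContDiff

/-- `∂_j g`. -/
noncomputable def partialD {n : ℕ} (j : Fin n) (g : EuclideanSpace ℝ (Fin n) → ℝ) :
    EuclideanSpace ℝ (Fin n) → ℝ :=
  fun x => fderiv ℝ g x (EuclideanSpace.single j 1)

/-- The iterated partial derivative `∂_{j₁} ⋯ ∂_{jₖ} g` for the list `J = [j₁, …, jₖ]`. For smooth
`g` this is `∂^α g` with the multi-index `α = e_{j₁} + ⋯ + e_{jₖ}`, so `|α| = J.length`. -/
noncomputable def iteratedPartialD {n : ℕ} (J : List (Fin n))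
    (g : EuclideanSpace ℝ (Fin n) → ℝ) : EuclideanSpace ℝ (Fin n) → ℝ :=
  J.foldr partialD g

/-- `Ω` is star shaped with respect to `B ⊆ Ω`: the convex hull of `B ∪ {y}` is contained in `Ω`
for every `y ∈ Ω`. -/
def IsStarShapedWrt {n : ℕ} (Ω B : Set (EuclideanSpace ℝ (Fin n))) : Prop :=
  B ⊆ Ω ∧ ∀ y ∈ Ω, convexHull ℝ (B ∪ {y}) ⊆ Ω

/-- `θ ∈ C_0^∞(B)` has integral one and
`‖∂^α θ‖_{L¹} ≤ K_α / diam(B)^{|α|}`, `‖∂^α θ‖_{L^∞} ≤ K_α / diam(B)^{n + |α|}` for all `α`. -/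
structure IsScaledBump {n : ℕ} (K : List (Fin n) → ℝ) (B : Set (EuclideanSpace ℝ (Fin n)))
    (θ : EuclideanSpace ℝ (Fin n) → ℝ) : Prop where
  contDiff : ContDiff ℝ ∞ θ
  hasCompactSupport : HasCompactSupport θ
  tsupport_subset : tsupport θ ⊆ B
  integral_eq_one : ∫ x, θ x = 1
  l1_bound : ∀ J : List (Fin n),
    ∫ x, |iteratedPartialD J θ x| ≤ K J / Metric.diam B ^ J.length
  linfty_bound : ∀ (J : List (Fin n)) (x : EuclideanSpace ℝ (Fin n)),
    |iteratedPartialD J θ x| ≤ K J / Metric.diam B ^ (n + J.length)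

/-- The integrand `θ(x + (y - x)/(1 - s)) (x_m - y_m)/(1 - s) f(y)`. -/
noncomputable def poincareIntegrand {n : ℕ} (m : Fin n) (θ f : EuclideanSpace ℝ (Fin n) → ℝ)
    (x : EuclideanSpace ℝ (Fin n)) (s : ℝ) (y : EuclideanSpace ℝ (Fin n)) : ℝ :=
  θ (x + (1 - s)⁻¹ • (y - x)) * ((x m - y m) / (1 - s)) * f y

/-- The reduced Poincaré-type operator
`P_ℓ f(x) = ∫_0^1 s^{ℓ-1} ∫ θ(x + (y-x)/(1-s)) (x_m - y_m)/(1-s) f(y) dy ds/(1-s)^n`. -/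
noncomputable def reducedPoincare {n : ℕ} (ℓ : ℕ) (m : Fin n)
    (θ f : EuclideanSpace ℝ (Fin n) → ℝ) (x : EuclideanSpace ℝ (Fin n)) : ℝ :=
  ∫ s in Set.Ioo (0 : ℝ) 1,
    s ^ (ℓ - 1) * (∫ y, poincareIntegrand m θ f x s y) * (1 / (1 - s) ^ n)

/-- The double integral defining `P_ℓ f(x)` converges absolutely. -/
def ReducedPoincareConverges {n : ℕ} (ℓ : ℕ) (m : Fin n)
    (θ f : EuclideanSpace ℝ (Fin n) → ℝ) (x : EuclideanSpace ℝ (Fin n)) : Prop :=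
  Integrable (fun p : ℝ × EuclideanSpace ℝ (Fin n) =>
      p.1 ^ (ℓ - 1) * poincareIntegrand m θ f x p.1 p.2 * (1 / (1 - p.1) ^ n))
    ((volume.restrict (Set.Ioo (0 : ℝ) 1)).prod volume)

/-- `g` is the weak partial derivative `∂_j u` on the open set `Ω`. -/
def HasWeakPartialD {n : ℕ} (Ω : Set (EuclideanSpace ℝ (Fin n))) (j : Fin n)
    (u g : EuclideanSpace ℝ (Fin n) → ℝ) : Prop :=
  LocallyIntegrableOn u Ω ∧ LocallyIntegrableOn g Ω ∧
    ∀ φ : EuclideanSpace ℝ (Fin n) → ℝ, ContDiff ℝ ∞ φ → HasCompactSupport φ → tsupport φ ⊆ Ω →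
      ∫ x in Ω, u x * partialD j φ x = -∫ x in Ω, g x * φ x

/-- `u ∈ H¹(Ω)` with weak gradient `g`: `u` and all `g j = ∂_j u` are in `L²(Ω)`. -/
def IsH1WithGradient {n : ℕ} (Ω : Set (EuclideanSpace ℝ (Fin n)))
    (u : EuclideanSpace ℝ (Fin n) → ℝ) (g : Fin n → EuclideanSpace ℝ (Fin n) → ℝ) : Prop :=
  MemLp u 2 (volume.restrict Ω) ∧
    ∀ j, MemLp (g j) 2 (volume.restrict Ω) ∧ HasWeakPartialD Ω j u (g j)

/-- `‖u‖_{L²(Ω)}` (for `u ∈ L²(Ω)`). -/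
noncomputable def l2Norm {n : ℕ} (Ω : Set (EuclideanSpace ℝ (Fin n)))
    (u : EuclideanSpace ℝ (Fin n) → ℝ) : ℝ :=
  (eLpNorm u 2 (volume.restrict Ω)).toReal

/-- The factor `κ`, as a function of `V = |Ω| / |B|`. -/
noncomputable def kappa (n ℓ : ℕ) (V : ℝ) : ℝ :=
  if n < 2 * ℓ then 1
  else if 2 * ℓ + 1 = n ∨ 2 * ℓ = n then
    1 + V ^ (((n : ℝ) - 2 * ℓ) / (2 * ((n : ℝ) - ℓ))) *
      Real.log V ^ ((n : ℝ) / (2 * ((n : ℝ) - ℓ)))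
  else
    1 + V ^ (((n : ℝ) - 2 * ℓ) / (2 * ((n : ℝ) - ℓ))) *
      Real.log V ^ ((n : ℝ) / (2 * ((n : ℝ) - ℓ - 1)))

/-!
Test `∂_j P_ℓ f` against `φ ∈ C_0^∞(Ω)`. With `w = x + (y - x) / (1 - s)` and `c` the centre of `B`,
the kernel of `P_ℓ` has `x_j`-derivative
`δ_{jm} θ(w) + s / (1 - s) * (∂_j ((w_m - c_m) θ)(w) - (x_m - c_m) ∂_j θ(w))`, up to the factor
`(1 - s)^(-n)`. The singular factor `s / (1 - s)` thus only multiplies bumps `ψ(w)` of vanishing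
integral at scale `ρ`.

Near `s = 1` the vanishing integral beats the singularity on the Fourier side: the form
`∬ φ(x) ψ(w) F(y) dx dy / (1 - s)^n` is the integral over `ξ` of the product of the transforms of
`F` at `ξ`, of `ψ` at `(1 - s) ξ` and of `φ` at `s ξ`, up to signs, and the transform of `ψ` at `η`
is of order `ρ |η| / (1 + ρ² |η|²)`. Divided by `1 - s`, this is integrable in `s` uniformly in `ξ`,
and Cauchy–Schwarz finishes.

For `s ≤ 1 / 2` there are two Schur bounds on the form, one by `s^(-n)` and one by `|Ω| / |B|`, both
up to powers of `1 - s`. Their geometric mean with exponent `l` is integrated against `s^(ℓ - 1)`,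
and the choice of `l` for given `n`, `ℓ` and `|Ω| / |B|` yields `κ`. The resulting `L²` bound on the
functional `φ ↦ ∫ P_ℓ f ∂_j φ` is turned into a weak derivative by Riesz representation.
-/

open scoped ENNReal

section Schur

variable {X Y : Type*} [MeasurableSpace X] [MeasurableSpace Y] {μ : Measure X} {ν : Measure Y}

lemma lintegral_mul_mul_le_rpow_mul_rpow {k F G : X → ℝ≥0∞} (hk : AEMeasurable k μ)
    (hF : AEMeasurable F μ) (hG : AEMeasurable G μ) :
    ∫⁻ x, k x * (F x * G x) ∂μ ≤
      (∫⁻ x, k x * F x ^ 2 ∂μ) ^ (1 / 2 : ℝ) * (∫⁻ x, k x * G x ^ 2 ∂μ) ^ (1 / 2 : ℝ) := by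
  have rpow_half_sq (a : ℝ≥0∞) : (a ^ 2) ^ (1 / 2 : ℝ) = a := by
    rw [← ENNReal.rpow_natCast, ← ENNReal.rpow_mul]; norm_num
  have rpow_half_mul_self (a : ℝ≥0∞) : a ^ (1 / 2 : ℝ) * a ^ (1 / 2 : ℝ) = a := by
    rw [← ENNReal.rpow_add_of_nonneg _ _ (by norm_num) (by norm_num)]; norm_num
  calc ∫⁻ x, k x * (F x * G x) ∂μ
      = ∫⁻ x, (k x * F x ^ 2) ^ (1 / 2 : ℝ) * (k x * G x ^ 2) ^ (1 / 2 : ℝ) ∂μ := by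
        refine lintegral_congr fun x => ?_
        rw [ENNReal.mul_rpow_of_nonneg _ _ (by norm_num),
          ENNReal.mul_rpow_of_nonneg _ _ (by norm_num), rpow_half_sq, rpow_half_sq,
          mul_mul_mul_comm, rpow_half_mul_self]
    _ ≤ _ := ENNReal.lintegral_mul_norm_pow_le (hk.mul (hF.pow_const 2))
        (hk.mul (hG.pow_const 2)) (by norm_num) (by norm_num) (by norm_num)

lemma sq_lintegral_mul_le {k F : X → ℝ≥0∞} (hk : AEMeasurable k μ) (hF : AEMeasurable F μ) :
    (∫⁻ x, k x * F x ∂μ) ^ 2 ≤ (∫⁻ x, k x ∂μ) * ∫⁻ x, k x * F x ^ 2 ∂μ := by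
  have h := lintegral_mul_mul_le_rpow_mul_rpow hk hF (G := fun _ => 1) aemeasurable_const
  simp only [mul_one, one_pow] at h
  refine (pow_le_pow_left' h 2).trans_eq ?_
  have rpow_half_sq (a : ℝ≥0∞) : (a ^ (1 / 2 : ℝ)) ^ 2 = a := by
    rw [← ENNReal.rpow_natCast, ← ENNReal.rpow_mul]; norm_num
  rw [mul_pow, rpow_half_sq, rpow_half_sq, mul_comm]

lemma eLpNorm_two_eq_lintegral_enorm_sq {V : Type*} [NormedAddCommGroup V] (f : X → V) :
    eLpNorm f 2 μ = (∫⁻ x, ‖f x‖ₑ ^ 2 ∂μ) ^ (1 / 2 : ℝ) := by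
  simp [eLpNorm_eq_lintegral_rpow_enorm_toReal two_ne_zero ENNReal.ofNat_ne_top]

variable [SFinite μ] [SFinite ν] {k : X → Y → ℝ≥0∞} {A B : ℝ≥0∞}

lemma lintegral_sq_lintegral_mul_le_of_schur (hk : Measurable (Function.uncurry k))
    {F : Y → ℝ≥0∞} (hF : Measurable F) (hA : ∀ᵐ x ∂μ, ∫⁻ y, k x y ∂ν ≤ A)
    (hB : ∀ᵐ y ∂ν, ∫⁻ x, k x y ∂μ ≤ B) :
    ∫⁻ x, (∫⁻ y, k x y * F y ∂ν) ^ 2 ∂μ ≤ A * B * ∫⁻ y, F y ^ 2 ∂ν := by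
  have hkx (x : X) : Measurable (k x) := hk.comp measurable_prodMk_left
  have hky (y : Y) : Measurable fun x => k x y := hk.comp measurable_prodMk_right
  have hm : Measurable fun p : X × Y => k p.1 p.2 * F p.2 ^ 2 :=
    hk.mul ((hF.comp measurable_snd).pow_const 2)
  calc ∫⁻ x, (∫⁻ y, k x y * F y ∂ν) ^ 2 ∂μ
      ≤ ∫⁻ x, A * ∫⁻ y, k x y * F y ^ 2 ∂ν ∂μ := by
        refine lintegral_mono_ae (hA.mono fun x hx => ?_)
        grw [sq_lintegral_mul_le (hkx x).aemeasurable hF.aemeasurable, hx]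
    _ = A * ∫⁻ y, (∫⁻ x, k x y ∂μ) * F y ^ 2 ∂ν := by
        rw [lintegral_const_mul _ hm.lintegral_prod_right',
          lintegral_lintegral_swap hm.aemeasurable]
        simp only [lintegral_mul_const _ (hky _)]
    _ ≤ A * ∫⁻ y, B * F y ^ 2 ∂ν := by
        gcongr _ * ?_
        exact lintegral_mono_ae (hB.mono fun y hy => by gcongr)
    _ = A * B * ∫⁻ y, F y ^ 2 ∂ν := by rw [lintegral_const_mul _ (hF.pow_const 2), mul_assoc]

lemma lintegral_mul_lintegral_mul_le_of_schur (hk : Measurable (Function.uncurry k))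
    {φ : X → ℝ≥0∞} (hφ : Measurable φ) {F : Y → ℝ≥0∞} (hF : Measurable F)
    (hA : ∀ᵐ x ∂μ, ∫⁻ y, k x y ∂ν ≤ A) (hB : ∀ᵐ y ∂ν, ∫⁻ x, k x y ∂μ ≤ B) :
    ∫⁻ x, φ x * ∫⁻ y, k x y * F y ∂ν ∂μ ≤
      (A * B) ^ (1 / 2 : ℝ) *
        ((∫⁻ y, F y ^ 2 ∂ν) ^ (1 / 2 : ℝ) * (∫⁻ x, φ x ^ 2 ∂μ) ^ (1 / 2 : ℝ)) := by
  have hm : Measurable fun x => ∫⁻ y, k x y * F y ∂ν :=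
    (hk.mul (hF.comp measurable_snd)).lintegral_prod_right'
  have h := lintegral_mul_mul_le_rpow_mul_rpow (μ := μ) (k := fun _ => 1) aemeasurable_const
    hφ.aemeasurable hm.aemeasurable
  simp only [one_mul] at h
  grw [h, lintegral_sq_lintegral_mul_le_of_schur hk hF hA hB,
    ENNReal.mul_rpow_of_nonneg (A * B) _ (by norm_num), mul_comm, mul_assoc]

end Schur

section SegmentForm

open Module

variable {E : Type*} [NormedAddCommGroup E] [InnerProductSpace ℝ E]

/-- The point `w` with `y = s x + (1 - s) w`, at which the kernel of `reducedPoincare` evaluates the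
bump. -/
noncomputable def segEnd (x : E) (s : ℝ) (y : E) : E := x + (1 - s)⁻¹ • (y - x)

lemma segEnd_eq_add_smul_right (x : E) (s : ℝ) (y : E) :
    segEnd x s y = (x - (1 - s)⁻¹ • x) + (1 - s)⁻¹ • y := by
  rw [segEnd, smul_sub]; abel

lemma segEnd_eq_add_smul_left {s : ℝ} (hs : s < 1) (x y : E) :
    segEnd x s y = (1 - s)⁻¹ • y + (-(s * (1 - s)⁻¹)) • x := by
  have h : 1 - s ≠ 0 := by linarith
  have : -(s * (1 - s)⁻¹) = 1 - (1 - s)⁻¹ := by field_simp; ring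
  rw [this, segEnd, smul_sub, sub_smul, one_smul]; abel

lemma smul_add_smul_segEnd {s : ℝ} (hs : s < 1) (x y : E) :
    s • x + (1 - s) • segEnd x s y = y := by
  have h : 1 - s ≠ 0 := by linarith
  rw [segEnd, smul_add, smul_smul, mul_inv_cancel₀ h, sub_smul, one_smul, one_smul]; abel

variable [FiniteDimensional ℝ E] [MeasurableSpace E] [BorelSpace E]

lemma measurable_segEnd : Measurable fun p : E × ℝ × E => segEnd p.1 p.2.1 p.2.2 := by
  unfold segEnd; fun_prop

lemma measurable_segEnd_prod (s : ℝ) : Measurable fun p : E × E => segEnd p.1 s p.2 := by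
  unfold segEnd; fun_prop

lemma lintegral_comp_add_smul (f : E → ℝ≥0∞) (a : E) {r : ℝ} (hr : r ≠ 0) :
    ∫⁻ x, f (a + r • x) = ENNReal.ofReal (|r|⁻¹ ^ finrank ℝ E) * ∫⁻ x, f x := by
  have hmap : ∫⁻ x, f (a + r • x) = ∫⁻ y, f (a + y) ∂(volume.map (r • · : E → E)) :=
    ((Homeomorph.smul (Units.mk0 r hr)).toMeasurableEquiv.measurableEmbedding.lintegral_map
      (μ := volume) (fun y => f (a + y))).symm
  rw [hmap, Measure.map_addHaar_smul volume hr, lintegral_smul_measure, lintegral_add_left_eq_self]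
  simp [abs_inv, abs_pow]

/-- The kernel `|ψ(w)| / (1 - s)^d` with `w = segEnd x s y` and `d = dim E`. -/
noncomputable def segKernel (ψ : E → ℝ) (s : ℝ) (x y : E) : ℝ≥0∞ :=
  ‖ψ (segEnd x s y)‖ₑ * ENNReal.ofReal (1 / (1 - s) ^ finrank ℝ E)

lemma measurable_segKernel {ψ : E → ℝ} (hψ : Measurable ψ) :
    Measurable fun p : E × ℝ × E => segKernel ψ p.2.1 p.1 p.2.2 :=
  (hψ.comp measurable_segEnd).enorm.mul (by fun_prop)

lemma measurable_uncurry_segKernel {ψ : E → ℝ} (hψ : Measurable ψ) (s : ℝ) :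
    Measurable (Function.uncurry (segKernel ψ s)) :=
  (hψ.comp (measurable_segEnd_prod s)).enorm.mul_const _

lemma lintegral_segKernel_right (ψ : E → ℝ) {s : ℝ} (hs : s < 1) (x : E) :
    ∫⁻ y, segKernel ψ s x y = ∫⁻ w, ‖ψ w‖ₑ := by
  have h : 0 < 1 - s := by linarith
  simp only [segKernel, segEnd_eq_add_smul_right]
  rw [lintegral_mul_const' _ _ ENNReal.ofReal_ne_top,
    lintegral_comp_add_smul (fun w => ‖ψ w‖ₑ) _ (inv_ne_zero h.ne'), mul_right_comm,
    ← ENNReal.ofReal_mul (by positivity), abs_of_pos (by positivity), inv_inv,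
    mul_one_div_cancel (by positivity), ENNReal.ofReal_one, one_mul]

lemma lintegral_segKernel_left (ψ : E → ℝ) {s : ℝ} (h0 : 0 < s) (hs : s < 1) (y : E) :
    ∫⁻ x, segKernel ψ s x y = ENNReal.ofReal (s⁻¹ ^ finrank ℝ E) * ∫⁻ w, ‖ψ w‖ₑ := by
  have : 0 < 1 - s := by linarith
  simp only [segKernel, segEnd_eq_add_smul_left hs]
  rw [lintegral_mul_const' _ _ ENNReal.ofReal_ne_top,
    lintegral_comp_add_smul (fun w => ‖ψ w‖ₑ) _ (neg_ne_zero.2 (by positivity)), mul_right_comm,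
    ← ENNReal.ofReal_mul (by positivity), abs_neg, abs_of_pos (by positivity), mul_inv, inv_inv,
    mul_pow, mul_assoc, mul_one_div_cancel (by positivity), mul_one]

lemma setLIntegral_segKernel_left_le {ψ : E → ℝ} {M : ℝ} (hM : ∀ w, |ψ w| ≤ M) (Ω : Set E)
    (s : ℝ) (y : E) :
    ∫⁻ x in Ω, segKernel ψ s x y ≤
      ENNReal.ofReal M * ENNReal.ofReal (1 / (1 - s) ^ finrank ℝ E) * volume Ω := by
  rw [← setLIntegral_const]
  refine lintegral_mono fun x => ?_
  rw [segKernel, Real.enorm_eq_ofReal_abs]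
  gcongr
  exact hM _

lemma integral_comp_segEnd {V : Type*} [NormedAddCommGroup V] [NormedSpace ℝ V] (g : E → V)
    (x : E) {s : ℝ} (hs : s < 1) :
    ∫ y, g (segEnd x s y) = (1 - s) ^ finrank ℝ E • ∫ w, g w := by
  have : 0 < 1 - s := by linarith
  simp only [segEnd_eq_add_smul_right]
  rw [Measure.integral_comp_smul volume (fun y => g (x - (1 - s)⁻¹ • x + y)) (1 - s)⁻¹,
    integral_add_left_eq_self g, abs_of_pos (by positivity), inv_pow, inv_inv]

/-- The bilinear form `∫∫ φ(x) ψ(w) F(y) dx dy / (1 - s)^d` with `w = segEnd x s y` and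
`d = dim E`. -/
noncomputable def segForm (s : ℝ) (ψ F φ : E → ℝ) : ℝ :=
  ∫ p : E × E, φ p.1 * (ψ (segEnd p.1 s p.2) * F p.2 * (1 / (1 - s) ^ finrank ℝ E))

variable {ψ F φ : E → ℝ} {s : ℝ}

lemma measurable_segForm_integrand (hψ : Measurable ψ) (hF : Measurable F) (hφ : Measurable φ)
    (s : ℝ) :
    Measurable fun p : E × E =>
      φ p.1 * (ψ (segEnd p.1 s p.2) * F p.2 * (1 / (1 - s) ^ finrank ℝ E)) :=
  (hφ.comp measurable_fst).mul (((hψ.comp (measurable_segEnd_prod s)).mul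
    (hF.comp measurable_snd)).mul_const _)

lemma lintegral_enorm_segForm_integrand (hψ : Measurable ψ) (hF : Measurable F)
    (hφ : Measurable φ) (hs : s < 1) :
    ∫⁻ p : E × E, ‖φ p.1 * (ψ (segEnd p.1 s p.2) * F p.2 * (1 / (1 - s) ^ finrank ℝ E))‖ₑ =
      ∫⁻ x, ‖φ x‖ₑ * ∫⁻ y, segKernel ψ s x y * ‖F y‖ₑ := by
  have : 0 < 1 - s := by linarith
  rw [Measure.volume_eq_prod, lintegral_prod _
    (measurable_segForm_integrand hψ hF hφ s).enorm.aemeasurable]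
  refine lintegral_congr fun x => ?_
  rw [← lintegral_const_mul' _ _ enorm_ne_top]
  refine lintegral_congr fun y => ?_
  rw [enorm_mul, enorm_mul, enorm_mul, segKernel,
    Real.enorm_of_nonneg (show 0 ≤ 1 / (1 - s) ^ finrank ℝ E by positivity)]
  ring

lemma lintegral_mul_lintegral_segKernel_mul_le (hψ : Measurable ψ) (hF : Measurable F)
    (hφ : Measurable φ) {Ω : Set E} (hφΩ : Function.support φ ⊆ Ω) (hs : s < 1) {B : ℝ≥0∞}
    (hB : ∀ y, ∫⁻ x in Ω, segKernel ψ s x y ≤ B) :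
    ∫⁻ x, ‖φ x‖ₑ * ∫⁻ y, segKernel ψ s x y * ‖F y‖ₑ ≤
      ((∫⁻ w, ‖ψ w‖ₑ) * B) ^ (1 / 2 : ℝ) * (eLpNorm F 2 volume * eLpNorm φ 2 volume) := by
  have hsupp : Function.support (fun x => ‖φ x‖ₑ * ∫⁻ y, segKernel ψ s x y * ‖F y‖ₑ) ⊆ Ω :=
    fun x hx => hφΩ fun h => hx (by simp [h])
  rw [← setLIntegral_eq_of_support_subset hsupp, ← eLpNorm_restrict_eq_of_support_subset hφΩ,
    eLpNorm_two_eq_lintegral_enorm_sq, eLpNorm_two_eq_lintegral_enorm_sq]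
  exact lintegral_mul_lintegral_mul_le_of_schur (measurable_uncurry_segKernel hψ s) hφ.enorm
    hF.enorm (ae_of_all _ fun x => (lintegral_segKernel_right ψ hs x).le) (ae_of_all _ hB)

lemma enorm_segForm_le (hψ : Measurable ψ) (hF : Measurable F) (hφ : Measurable φ) {Ω : Set E}
    (hφΩ : Function.support φ ⊆ Ω) (hs : s < 1) {B : ℝ≥0∞}
    (hB : ∀ y, ∫⁻ x in Ω, segKernel ψ s x y ≤ B) :
    ‖segForm s ψ F φ‖ₑ ≤
      ((∫⁻ w, ‖ψ w‖ₑ) * B) ^ (1 / 2 : ℝ) * (eLpNorm F 2 volume * eLpNorm φ 2 volume) := by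
  refine (enorm_integral_le_lintegral_enorm _).trans ?_
  rw [lintegral_enorm_segForm_integrand hψ hF hφ hs]
  exact lintegral_mul_lintegral_segKernel_mul_le hψ hF hφ hφΩ hs hB

lemma setLIntegral_univ_segKernel_left (ψ : E → ℝ) (h0 : 0 < s) (hs : s < 1) (y : E) :
    ∫⁻ x in Set.univ, segKernel ψ s x y =
      ENNReal.ofReal (s⁻¹ ^ finrank ℝ E) * ∫⁻ w, ‖ψ w‖ₑ := by
  rw [setLIntegral_univ, lintegral_segKernel_left ψ h0 hs]

lemma rpow_half_lintegral_mul_ne_top (hψi : Integrable ψ) (s : ℝ) :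
    ((∫⁻ w, ‖ψ w‖ₑ) * (ENNReal.ofReal (s⁻¹ ^ finrank ℝ E) * ∫⁻ w, ‖ψ w‖ₑ)) ^ (1 / 2 : ℝ) ≠ ⊤ :=
  have := hψi.2.ne
  (ENNReal.rpow_lt_top_of_nonneg (by norm_num) (by finiteness)).ne

lemma integrable_segForm_integrand (hψ : Measurable ψ) (hψi : Integrable ψ) (hF : Measurable F)
    (hF2 : MemLp F 2 volume) (hφ : Measurable φ) (hφ2 : MemLp φ 2 volume) (h0 : 0 < s)
    (hs : s < 1) :
    Integrable fun p : E × E =>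
      φ p.1 * (ψ (segEnd p.1 s p.2) * F p.2 * (1 / (1 - s) ^ finrank ℝ E)) := by
  refine ⟨(measurable_segForm_integrand hψ hF hφ s).aestronglyMeasurable, ?_⟩
  rw [hasFiniteIntegral_iff_enorm, lintegral_enorm_segForm_integrand hψ hF hφ hs]
  exact (lintegral_mul_lintegral_segKernel_mul_le hψ hF hφ (Set.subset_univ _) hs fun y =>
    (setLIntegral_univ_segKernel_left ψ h0 hs y).le).trans_lt
    (ENNReal.mul_lt_top (rpow_half_lintegral_mul_ne_top hψi s).lt_top
      (ENNReal.mul_lt_top hF2.2 hφ2.2))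

lemma segForm_eq_integral_integral (hψ : Measurable ψ) (hψi : Integrable ψ) (hF : Measurable F)
    (hF2 : MemLp F 2 volume) (hφ : Measurable φ) (hφ2 : MemLp φ 2 volume) (h0 : 0 < s)
    (hs : s < 1) :
    segForm s ψ F φ = ∫ x, φ x * ∫ w, ψ w * F (s • x + (1 - s) • w) := by
  have : 0 < 1 - s := by linarith
  have hi := integrable_segForm_integrand hψ hψi hF hF2 hφ hφ2 h0 hs
  rw [segForm, Measure.volume_eq_prod] at *
  rw [integral_prod _ hi]
  refine integral_congr_ae (ae_of_all _ fun x => ?_)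
  have hinner := integral_comp_segEnd (fun w => ψ w * F (s • x + (1 - s) • w)) x hs
  simp only [smul_add_smul_segEnd hs, smul_eq_mul] at hinner
  simp only
  rw [integral_const_mul, integral_mul_const, hinner]
  field_simp

lemma segForm_sub {G : E → ℝ} (hψ : Measurable ψ) (hψi : Integrable ψ) (hF : Measurable F)
    (hF2 : MemLp F 2 volume) (hG : Measurable G) (hG2 : MemLp G 2 volume) (hφ : Measurable φ)
    (hφ2 : MemLp φ 2 volume) (h0 : 0 < s) (hs : s < 1) :
    segForm s ψ (F - G) φ = segForm s ψ F φ - segForm s ψ G φ := by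
  rw [segForm, segForm, segForm, ← integral_sub
    (integrable_segForm_integrand hψ hψi hF hF2 hφ hφ2 h0 hs)
    (integrable_segForm_integrand hψ hψi hG hG2 hφ hφ2 h0 hs)]
  refine integral_congr_ae (ae_of_all _ fun p => ?_)
  simp only [Pi.sub_apply]
  ring

open Filter Topology in
lemma tendsto_segForm {G : ℕ → E → ℝ} (hψ : Measurable ψ) (hψi : Integrable ψ) (hF : Measurable F)
    (hF2 : MemLp F 2 volume) (hG : ∀ k, Measurable (G k)) (hG2 : ∀ k, MemLp (G k) 2 volume)
    (hφ : Measurable φ) (hφ2 : MemLp φ 2 volume) (h0 : 0 < s) (hs : s < 1)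
    (hlim : Tendsto (fun k => eLpNorm (F - G k) 2 volume) atTop (𝓝 0)) :
    Tendsto (fun k => segForm s ψ (G k) φ) atTop (𝓝 (segForm s ψ F φ)) := by
  set C := ((∫⁻ w, ‖ψ w‖ₑ) * (ENNReal.ofReal (s⁻¹ ^ finrank ℝ E) * ∫⁻ w, ‖ψ w‖ₑ)) ^ (1 / 2 : ℝ)
  have hbound (k : ℕ) : edist (segForm s ψ (G k) φ) (segForm s ψ F φ) ≤
      C * (eLpNorm (F - G k) 2 volume * eLpNorm φ 2 volume) := by
    rw [edist_comm, edist_eq_enorm_sub, ← segForm_sub hψ hψi hF hF2 (hG k) (hG2 k) hφ hφ2 h0 hs]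
    exact enorm_segForm_le hψ (hF.sub (hG k)) hφ (Set.subset_univ _) hs fun y =>
      (setLIntegral_univ_segKernel_left ψ h0 hs y).le
  rw [tendsto_iff_edist_tendsto_0]
  refine tendsto_of_tendsto_of_tendsto_of_le_of_le tendsto_const_nhds ?_ (fun _ => zero_le) hbound
  have htendsto := ENNReal.Tendsto.const_mul (a := C) (ENNReal.Tendsto.mul_const hlim
    (Or.inr hφ2.2.ne)) (Or.inr (rpow_half_lintegral_mul_ne_top hψi s))
  rwa [zero_mul, mul_zero] at htendsto

end SegmentForm

section FourierBounds

open FourierTransform SchwartzMap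
open scoped RealInnerProductSpace

lemma norm_fourierChar_sub_le (a b : ℝ) : ‖(𝐞 a : ℂ) - (𝐞 b : ℂ)‖ ≤ 2 * Real.pi * |a - b| := by
  have hsplit : (𝐞 a : ℂ) - (𝐞 b : ℂ) =
      (𝐞 b : ℂ) * (Complex.exp (Complex.I * ((2 * Real.pi * (a - b) : ℝ) : ℂ)) - 1) := by
    rw [Real.fourierChar_apply, Real.fourierChar_apply, mul_sub, ← Complex.exp_add, mul_one]
    congr 2
    push_cast
    ring
  rw [hsplit, norm_mul, Circle.norm_coe, one_mul]
  refine Real.norm_exp_I_mul_ofReal_sub_one_le.trans_eq ?_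
  rw [Real.norm_eq_abs, abs_mul, abs_of_pos (by positivity)]

variable {E : Type*} [NormedAddCommGroup E] [InnerProductSpace ℝ E]

/-- A real test function as a complex Schwartz function, to which Plancherel's theorem applies. -/
noncomputable def toComplexSchwartz {ψ : E → ℝ} (h : ContDiff ℝ ∞ ψ) (hc : HasCompactSupport ψ) :
    𝓢(E, ℂ) :=
  HasCompactSupport.toSchwartzMap (f := fun x => (ψ x : ℂ))
    (hc.comp_left (g := fun a : ℝ => (a : ℂ)) (by simp)) (Complex.ofRealCLM.contDiff.comp h)

lemma toComplexSchwartz_apply {ψ : E → ℝ} (h : ContDiff ℝ ∞ ψ) (hc : HasCompactSupport ψ) (x : E) :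
    toComplexSchwartz h hc x = (ψ x : ℂ) := rfl

lemma norm_lineDerivOp_toComplexSchwartz {ψ : E → ℝ} (h : ContDiff ℝ ∞ ψ)
    (hc : HasCompactSupport ψ) (v w : E) :
    ‖LineDeriv.lineDerivOp v (toComplexSchwartz h hc) w‖ = |fderiv ℝ ψ w v| := by
  have hd : HasFDerivAt (toComplexSchwartz h hc : E → ℂ)
      (Complex.ofRealCLM.comp (fderiv ℝ ψ w)) w :=
    Complex.ofRealCLM.hasFDerivAt.comp w (h.differentiable (by simp) w).hasFDerivAt
  rw [lineDerivOp_apply_eq_fderiv, hd.fderiv]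
  simp

variable [FiniteDimensional ℝ E] [MeasurableSpace E] [BorelSpace E]

open Module in
/-- A smooth compactly supported function with vanishing integral, supported in the closed ball of
radius `ρ` around `c`, and with the bounds of an amplitude-`A` bump at scale `ρ`. Near `s = 1`
the vanishing integral compensates the singularity `1 / (1 - s)` of the differentiated kernel. -/
structure IsMeanZeroBump (c : E) (ρ A : ℝ) (ψ : E → ℝ) : Prop where
  contDiff : ContDiff ℝ ∞ ψ
  hasCompactSupport : HasCompactSupport ψ
  support_subset : Function.support ψ ⊆ Metric.closedBall c ρ
  integral_eq_zero : ∫ w, ψ w = 0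
  l1_bound : ∫ w, |ψ w| ≤ A
  l1_fderiv_bound : ∫ w, ‖fderiv ℝ ψ w‖ ≤ A / ρ
  linfty_bound : ∀ w, |ψ w| ≤ A / ρ ^ finrank ℝ E

lemma IsMeanZeroBump.nonneg {c : E} {ρ A : ℝ} {ψ : E → ℝ} (h : IsMeanZeroBump c ρ A ψ) : 0 ≤ A :=
  (integral_nonneg fun _ => abs_nonneg _).trans h.l1_bound

lemma norm_integral_fourierChar_inner_mul_le {c : E} {ρ : ℝ} {ψ : E → ℝ} (hψ : Integrable ψ)
    (hsupp : Function.support ψ ⊆ Metric.closedBall c ρ) (hint : ∫ w, ψ w = 0) (ξ : E) :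
    ‖∫ w, (𝐞 ⟪w, ξ⟫ : ℂ) * (ψ w : ℂ)‖ ≤ 2 * Real.pi * (ρ * ‖ξ‖) * ∫ w, |ψ w| := by
  have hcenter : ∫ w, (𝐞 ⟪w, ξ⟫ : ℂ) * (ψ w : ℂ) =
      ∫ w, ((𝐞 ⟪w, ξ⟫ : ℂ) - (𝐞 ⟪c, ξ⟫ : ℂ)) * (ψ w : ℂ) := by
    have hint' : ∫ w, (ψ w : ℂ) = 0 := by rw [integral_complex_ofReal, hint, Complex.ofReal_zero]
    simp only [sub_mul]
    rw [integral_sub _ (hψ.ofReal.const_mul _), integral_const_mul, hint', mul_zero, sub_zero]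
    exact hψ.ofReal.bdd_mul (c := 1) (by fun_prop) (ae_of_all _ fun w => (Circle.norm_coe _).le)
  rw [hcenter, ← integral_const_mul]
  refine (norm_integral_le_integral_norm _).trans (integral_mono_of_nonneg
    (ae_of_all _ fun w => norm_nonneg _) (hψ.abs.const_mul _) (ae_of_all _ fun w => ?_))
  simp only [norm_mul, Complex.norm_real, Real.norm_eq_abs]
  by_cases hw : ψ w = 0
  · simp [hw]
  gcongr
  calc ‖(𝐞 ⟪w, ξ⟫ : ℂ) - (𝐞 ⟪c, ξ⟫ : ℂ)‖
      ≤ 2 * Real.pi * |⟪w - c, ξ⟫| := by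
        rw [inner_sub_left]
        exact norm_fourierChar_sub_le _ _
    _ ≤ 2 * Real.pi * (‖w - c‖ * ‖ξ‖) := by grw [abs_real_inner_le_norm]
    _ ≤ 2 * Real.pi * (ρ * ‖ξ‖) := by grw [mem_closedBall_iff_norm.1 (hsupp hw)]

lemma eLpNorm_toComplexSchwartz {ψ : E → ℝ} (h : ContDiff ℝ ∞ ψ) (hc : HasCompactSupport ψ) :
    eLpNorm (toComplexSchwartz h hc) 2 volume = eLpNorm ψ 2 volume :=
  eLpNorm_congr_norm_ae (ae_of_all _ fun x => by rw [toComplexSchwartz_apply, Complex.norm_real])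

lemma fourierInv_smul_eq_integral (f : 𝓢(E, ℂ)) (r : ℝ) (ξ : E) :
    𝓕⁻ f (r • ξ) = ∫ x, (𝐞 (r * ⟪x, ξ⟫) : ℂ) * f x := by
  rw [fourierInv_coe, Real.fourierInv_eq]
  simp only [inner_smul_right, Circle.smul_def, smul_eq_mul]

lemma fourierInv_eq_integral (f : 𝓢(E, ℂ)) (ξ : E) : 𝓕⁻ f ξ = ∫ x, (𝐞 ⟪x, ξ⟫ : ℂ) * f x := by
  simpa using fourierInv_smul_eq_integral f 1 ξ

lemma norm_fourierInv_le_integral_norm (f : 𝓢(E, ℂ)) (ξ : E) : ‖𝓕⁻ f ξ‖ ≤ ∫ w, ‖f w‖ := by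
  rw [fourierInv_eq_integral]
  refine (norm_integral_le_integral_norm _).trans_eq ?_
  simp only [norm_mul, Circle.norm_coe, one_mul]

lemma norm_mul_norm_fourierInv_le {ψ : E → ℝ} (h : ContDiff ℝ ∞ ψ) (hc : HasCompactSupport ψ)
    (ξ : E) :
    ‖ξ‖ * ‖𝓕⁻ (toComplexSchwartz h hc) ξ‖ ≤ ∫ w, ‖fderiv ℝ ψ w‖ := by
  rcases eq_or_ne ξ 0 with rfl | hξ
  · simpa using integral_nonneg fun w => norm_nonneg (fderiv ℝ ψ w)
  set f := toComplexSchwartz h hc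
  have hi : Integrable fun w => ‖fderiv ℝ ψ w‖ :=
    ((h.continuous_fderiv (by simp)).integrable_of_hasCompactSupport (hc.fderiv ℝ)).norm
  have htg : (fun x : E => ⟪x, ξ⟫).HasTemperateGrowth := ((innerSL ℝ).flip ξ).hasTemperateGrowth
  have hderiv : ‖𝓕⁻ (LineDeriv.lineDerivOp ξ f) ξ‖ = 2 * Real.pi * ‖ξ‖ ^ 2 * ‖𝓕⁻ f ξ‖ := by
    rw [fourierInv_lineDerivOp_eq, smul_apply, smulLeftCLM_apply_apply htg]
    simp [abs_of_pos Real.pi_pos, mul_assoc]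
  have hbound : 2 * Real.pi * ‖ξ‖ ^ 2 * ‖𝓕⁻ f ξ‖ ≤ (∫ w, ‖fderiv ℝ ψ w‖) * ‖ξ‖ := by
    rw [← hderiv, ← integral_mul_const]
    refine (norm_fourierInv_le_integral_norm _ ξ).trans (integral_mono_of_nonneg
      (ae_of_all _ fun w => norm_nonneg _) (hi.mul_const _) (ae_of_all _ fun w => ?_))
    simp only
    rw [norm_lineDerivOp_toComplexSchwartz, ← Real.norm_eq_abs]
    exact (fderiv ℝ ψ w).le_opNorm ξ
  have hpi : 1 ≤ 2 * Real.pi := by linarith [Real.pi_gt_three]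
  refine le_of_mul_le_mul_right ((?_ : _ ≤ _).trans hbound) (norm_pos_iff.2 hξ)
  calc ‖ξ‖ * ‖𝓕⁻ f ξ‖ * ‖ξ‖ = 1 * (‖ξ‖ ^ 2 * ‖𝓕⁻ f ξ‖) := by ring
    _ ≤ 2 * Real.pi * (‖ξ‖ ^ 2 * ‖𝓕⁻ f ξ‖) := by gcongr
    _ = 2 * Real.pi * ‖ξ‖ ^ 2 * ‖𝓕⁻ f ξ‖ := by ring

lemma IsMeanZeroBump.norm_fourierInv_le {c : E} {ρ A : ℝ} (hρ : 0 < ρ) {ψ : E → ℝ}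
    (h : IsMeanZeroBump c ρ A ψ) (ξ : E) :
    ‖𝓕⁻ (toComplexSchwartz h.contDiff h.hasCompactSupport) ξ‖ ≤
      (2 * Real.pi + 1) * A * (ρ * ‖ξ‖ / (1 + (ρ * ‖ξ‖) ^ 2)) := by
  have hsmall : ‖𝓕⁻ (toComplexSchwartz h.contDiff h.hasCompactSupport) ξ‖ ≤
      2 * Real.pi * (ρ * ‖ξ‖) * A := by
    rw [fourierInv_eq_integral]
    grw [← h.l1_bound]
    exact norm_integral_fourierChar_inner_mul_le
      (h.contDiff.continuous.integrable_of_hasCompactSupport h.hasCompactSupport)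
      h.support_subset h.integral_eq_zero ξ
  have hlarge : ρ * ‖ξ‖ * ‖𝓕⁻ (toComplexSchwartz h.contDiff h.hasCompactSupport) ξ‖ ≤ A := by
    rw [mul_assoc, ← le_div_iff₀' hρ]
    exact (norm_mul_norm_fourierInv_le _ _ ξ).trans h.l1_fderiv_bound
  set M := ‖𝓕⁻ (toComplexSchwartz h.contDiff h.hasCompactSupport) ξ‖
  have hv : 0 ≤ ρ * ‖ξ‖ := by positivity
  rw [← mul_div_assoc, le_div_iff₀ (by positivity)]
  nlinarith [mul_le_mul_of_nonneg_left hlarge hv]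

lemma integral_mul_integral_fourierChar {a b : E → ℂ} (ha : Integrable a) (hb : Integrable b)
    (r : ℝ) :
    ∫ x, a x * ∫ ξ, (𝐞 (r * ⟪x, ξ⟫) : ℂ) * b ξ = ∫ ξ, b ξ * ∫ x, (𝐞 (r * ⟪x, ξ⟫) : ℂ) * a x := by
  have h := VectorFourier.integral_fourierIntegral_smul_eq_flip (L := (-r) • innerₗ E)
    Real.continuous_fourierChar (by simp only [LinearMap.smul_apply, innerₗ_apply_apply]; fun_prop)
    hb ha
  simp only [VectorFourier.fourierIntegral, LinearMap.smul_apply, LinearMap.flip_apply,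
    innerₗ_apply_apply, smul_eq_mul, neg_mul, neg_neg, Circle.smul_def] at h
  simpa only [mul_comm (a _), real_inner_comm] using h

/-- The operator `F ↦ ∫ ψ(w) F(s x + t w) dw` is a Fourier multiplier combined with a dilation. -/
lemma integral_mul_integral_segment_eq_fourier (F φ ψ : 𝓢(E, ℂ)) (s t : ℝ) :
    ∫ x, φ x * ∫ w, ψ w * F (s • x + t • w) =
      ∫ ξ, 𝓕 F ξ * 𝓕⁻ ψ (t • ξ) * 𝓕⁻ φ (s • ξ) := by
  have hFi : Integrable (𝓕 F : 𝓢(E, ℂ)) := (𝓕 F).integrable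
  have hinner (x : E) : ∫ w, ψ w * F (s • x + t • w) =
      ∫ ξ, (𝐞 (s * ⟪x, ξ⟫) : ℂ) * (𝓕 F ξ * 𝓕⁻ ψ (t • ξ)) := by
    have hb : Integrable fun ξ => (𝐞 (s * ⟪x, ξ⟫) : ℂ) * 𝓕 F ξ :=
      hFi.bdd_mul (c := 1) (by fun_prop) (ae_of_all _ fun ξ => (Circle.norm_coe _).le)
    have hinv (w : E) : F (s • x + t • w) =
        ∫ ξ, (𝐞 (t * ⟪w, ξ⟫) : ℂ) * ((𝐞 (s * ⟪x, ξ⟫) : ℂ) * 𝓕 F ξ) := by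
      have hF : F (s • x + t • w) = 𝓕⁻ (𝓕 F : 𝓢(E, ℂ)) (s • x + t • w) := by simp
      rw [hF, fourierInv_eq_integral]
      simp only [inner_add_right, inner_smul_right, AddChar.map_add_eq_mul, Circle.coe_mul,
        real_inner_comm, mul_comm, mul_left_comm]
    simp only [hinv, integral_mul_integral_fourierChar ψ.integrable hb t,
      fourierInv_smul_eq_integral, mul_assoc]
  have hb : Integrable fun ξ => 𝓕 F ξ * 𝓕⁻ ψ (t • ξ) :=
    hFi.mul_bdd (c := ∫ w, ‖ψ w‖)
      ((𝓕⁻ ψ).continuous.comp (continuous_const_smul t)).aestronglyMeasurable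
      (ae_of_all _ fun ξ => norm_fourierInv_le_integral_norm ψ _)
  simp only [hinner, integral_mul_integral_fourierChar φ.integrable hb s,
    fourierInv_smul_eq_integral φ]

lemma eLpNorm_fourier_eq (f : 𝓢(E, ℂ)) :
    eLpNorm (𝓕 f : 𝓢(E, ℂ)) 2 volume = eLpNorm f 2 volume := by
  have eLpNorm_eq (g : 𝓢(E, ℂ)) : eLpNorm g 2 volume = ‖g.toLp 2‖ₑ := by
    rw [Lp.enorm_def, eLpNorm_congr_ae (coeFn_toLp g 2 volume)]
  rw [eLpNorm_eq, eLpNorm_eq, ← ofReal_norm, ← ofReal_norm, norm_fourier_toL2_eq]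

lemma eLpNorm_fourierInv_eq (f : 𝓢(E, ℂ)) :
    eLpNorm (𝓕⁻ f : 𝓢(E, ℂ)) 2 volume = eLpNorm f 2 volume := by
  rw [← eLpNorm_fourier_eq (𝓕⁻ f)]; simp

end FourierBounds

section NearDiagonal

open FourierTransform SchwartzMap Module Filter Topology

lemma lintegral_div_one_add_mul_sq_le {b : ℝ} (hb : 0 ≤ b) :
    ∫⁻ t : ℝ, ENNReal.ofReal (b / (1 + (b * t) ^ 2)) ≤ ENNReal.ofReal Real.pi := by
  rcases hb.eq_or_lt with rfl | hb
  · simp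
  have hi : Integrable fun t : ℝ => b * (1 + (b * t) ^ 2)⁻¹ :=
    (integrable_inv_one_add_sq.comp_mul_left' hb.ne').const_mul b
  simp only [div_eq_mul_inv]
  rw [← ofReal_integral_eq_lintegral_ofReal hi (ae_of_all _ fun t => by positivity),
    integral_const_mul, Measure.integral_comp_mul_left (fun x : ℝ => (1 + x ^ 2)⁻¹),
    integral_univ_inv_one_add_sq, abs_of_pos (by positivity), smul_eq_mul,
    mul_inv_cancel_left₀ hb.ne']

variable {E : Type*} [NormedAddCommGroup E]

/-- The majorant of `(1 - s)⁻¹ |ψ̌ ((1 - s) ξ)|` for a mean-zero bump `ψ` at scale `ρ`; it is the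
weight of the Cauchy–Schwarz inequality on the Fourier side. -/
noncomputable def nearWeight (ρ s : ℝ) (ξ : E) : ℝ≥0∞ :=
  ENNReal.ofReal (ρ * ‖ξ‖ / (1 + (ρ * ‖ξ‖ * (1 - s)) ^ 2))

lemma setLIntegral_nearWeight_le {ρ : ℝ} (hρ : 0 ≤ ρ) (S : Set ℝ) (ξ : E) :
    ∫⁻ s in S, nearWeight ρ s ξ ≤ ENNReal.ofReal Real.pi := by
  refine (setLIntegral_le_lintegral _ _).trans ?_
  unfold nearWeight
  rw [lintegral_sub_left_eq_self (μ := (volume : Measure ℝ))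
    (fun t => ENNReal.ofReal (ρ * ‖ξ‖ / (1 + (ρ * ‖ξ‖ * t) ^ 2))) 1]
  exact lintegral_div_one_add_mul_sq_le (by positivity)

lemma nearWeight_inv_smul_le [NormedSpace ℝ E] {ρ s : ℝ} (hρ : 0 ≤ ρ) (h0 : 1 / 2 < s) (h1 : s < 1)
    (η : E) : nearWeight ρ s (s⁻¹ • η) ≤ ENNReal.ofReal 2 * nearWeight ρ s η := by
  have hs : 0 < s := by linarith
  have ht : 0 ≤ 1 - s := by linarith
  have hs1 : (1 : ℝ) ≤ s⁻¹ := (one_le_inv₀ hs).2 h1.le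
  have hs2 : s⁻¹ ≤ 2 := by rw [inv_le_comm₀ hs (by norm_num)]; linarith
  rw [nearWeight, nearWeight, ← ENNReal.ofReal_mul (by norm_num), norm_smul, norm_inv,
    Real.norm_of_nonneg hs.le, mul_left_comm, ← mul_div_assoc]
  have : ρ * ‖η‖ * (1 - s) ≤ s⁻¹ * (ρ * ‖η‖) * (1 - s) :=
    mul_le_mul_of_nonneg_right (le_mul_of_one_le_left (by positivity) hs1) ht
  gcongr

variable [MeasurableSpace E] [BorelSpace E]

lemma measurable_nearWeight (ρ : ℝ) : Measurable fun p : ℝ × E => nearWeight ρ p.1 p.2 :=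
  ENNReal.measurable_ofReal.comp (Measurable.div (by fun_prop) (by fun_prop))

variable [InnerProductSpace ℝ E] [FiniteDimensional ℝ E]

lemma lintegral_nearWeight_mul_sq_le {ρ : ℝ} (hρ : 0 ≤ ρ) (S : Set ℝ) {G : E → ℝ≥0∞}
    (hG : Measurable G) :
    ∫⁻ s in S, ∫⁻ ξ, nearWeight ρ s ξ * G ξ ^ 2 ≤ ENNReal.ofReal Real.pi * ∫⁻ ξ, G ξ ^ 2 := by
  have hm : Measurable fun p : ℝ × E => nearWeight ρ p.1 p.2 * G p.2 ^ 2 :=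
    (measurable_nearWeight ρ).mul ((hG.comp measurable_snd).pow_const 2)
  have hw (ξ : E) : Measurable fun s : ℝ => nearWeight ρ s ξ :=
    (measurable_nearWeight ρ).comp measurable_prodMk_right
  calc ∫⁻ s in S, ∫⁻ ξ, nearWeight ρ s ξ * G ξ ^ 2
      = ∫⁻ ξ, ∫⁻ s in S, nearWeight ρ s ξ * G ξ ^ 2 := lintegral_lintegral_swap hm.aemeasurable
    _ = ∫⁻ ξ, (∫⁻ s in S, nearWeight ρ s ξ) * G ξ ^ 2 :=
        lintegral_congr fun ξ => lintegral_mul_const _ (hw ξ)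
    _ ≤ ∫⁻ ξ, ENNReal.ofReal Real.pi * G ξ ^ 2 :=
        lintegral_mono fun ξ => mul_le_mul_left (setLIntegral_nearWeight_le hρ S ξ) _
    _ = ENNReal.ofReal Real.pi * ∫⁻ ξ, G ξ ^ 2 := lintegral_const_mul _ (hG.pow_const 2)

lemma lintegral_nearWeight_mul_comp_smul_sq_le {ρ : ℝ} (hρ : 0 ≤ ρ) {G : E → ℝ≥0∞}
    (hG : Measurable G) :
    ∫⁻ s in Set.Ioo (1 / 2 : ℝ) 1, ∫⁻ ξ, nearWeight ρ s ξ * G (s • ξ) ^ 2 ≤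
      ENNReal.ofReal (Real.pi * 2 ^ (finrank ℝ E + 1)) * ∫⁻ ξ, G ξ ^ 2 := by
  have hdilate {s : ℝ} (hs : s ∈ Set.Ioo (1 / 2 : ℝ) 1) :
      ∫⁻ ξ, nearWeight ρ s ξ * G (s • ξ) ^ 2 ≤
        ENNReal.ofReal (2 ^ (finrank ℝ E + 1)) * ∫⁻ ξ, nearWeight ρ s ξ * G ξ ^ 2 := by
    have hs0 : 0 < s := by linarith [hs.1]
    have hcov := lintegral_comp_add_smul
      (fun η : E => nearWeight ρ s (s⁻¹ • η) * G η ^ 2) 0 hs0.ne'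
    simp only [zero_add, inv_smul_smul₀ hs0.ne'] at hcov
    rw [hcov, abs_of_pos hs0, pow_succ, ENNReal.ofReal_mul (by positivity), mul_assoc]
    gcongr
    · rw [inv_le_comm₀ hs0 (by norm_num)]; linarith [hs.1]
    · rw [← lintegral_const_mul' _ _ ENNReal.ofReal_ne_top]
      refine lintegral_mono fun η => ?_
      rw [← mul_assoc]
      exact mul_le_mul_left (nearWeight_inv_smul_le hρ hs.1 hs.2 η) _
  calc ∫⁻ s in Set.Ioo (1 / 2 : ℝ) 1, ∫⁻ ξ, nearWeight ρ s ξ * G (s • ξ) ^ 2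
      ≤ ∫⁻ s in Set.Ioo (1 / 2 : ℝ) 1, ENNReal.ofReal (2 ^ (finrank ℝ E + 1)) *
          ∫⁻ ξ, nearWeight ρ s ξ * G ξ ^ 2 :=
        setLIntegral_mono' measurableSet_Ioo fun s hs => hdilate hs
    _ = ENNReal.ofReal (2 ^ (finrank ℝ E + 1)) * ∫⁻ s in Set.Ioo (1 / 2 : ℝ) 1,
          ∫⁻ ξ, nearWeight ρ s ξ * G ξ ^ 2 := lintegral_const_mul' _ _ ENNReal.ofReal_ne_top
    _ ≤ ENNReal.ofReal (2 ^ (finrank ℝ E + 1)) *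
          (ENNReal.ofReal Real.pi * ∫⁻ ξ, G ξ ^ 2) := by
        gcongr; exact lintegral_nearWeight_mul_sq_le hρ _ hG
    _ = ENNReal.ofReal (Real.pi * 2 ^ (finrank ℝ E + 1)) * ∫⁻ ξ, G ξ ^ 2 := by
        rw [← mul_assoc, ← ENNReal.ofReal_mul (by positivity), mul_comm (_ ^ _)]

lemma lintegral_nearWeight_mul_mul_comp_smul_le {ρ : ℝ} (hρ : 0 ≤ ρ) {G P : E → ℝ≥0∞}
    (hG : Measurable G) (hP : Measurable P) :
    ∫⁻ s in Set.Ioo (1 / 2 : ℝ) 1, ∫⁻ ξ, nearWeight ρ s ξ * (G ξ * P (s • ξ)) ≤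
      ENNReal.ofReal (Real.pi * 2 ^ (finrank ℝ E + 1)) *
        ((∫⁻ ξ, G ξ ^ 2) ^ (1 / 2 : ℝ) * (∫⁻ ξ, P ξ ^ 2) ^ (1 / 2 : ℝ)) := by
  have hw := measurable_nearWeight (E := E) ρ
  have hG' : Measurable fun p : ℝ × E => G p.2 := hG.comp measurable_snd
  have hP' : Measurable fun p : ℝ × E => P (p.1 • p.2) := hP.comp (by fun_prop)
  have hcs := lintegral_mul_mul_le_rpow_mul_rpow
    (μ := (volume.restrict (Set.Ioo (1 / 2 : ℝ) 1)).prod (volume : Measure E))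
    hw.aemeasurable hG'.aemeasurable hP'.aemeasurable
  rw [lintegral_prod _ (by fun_prop), lintegral_prod _ (by fun_prop),
    lintegral_prod _ (by fun_prop)] at hcs
  refine hcs.trans ?_
  set c := ENNReal.ofReal (Real.pi * 2 ^ (finrank ℝ E + 1))
  have hc : c = c ^ (1 / 2 : ℝ) * c ^ (1 / 2 : ℝ) := by
    rw [← ENNReal.rpow_add_of_nonneg _ _ (by norm_num) (by norm_num)]; norm_num
  have hpi : ENNReal.ofReal Real.pi ≤ c := ENNReal.ofReal_le_ofReal
    (le_mul_of_one_le_right Real.pi_pos.le (one_le_pow₀ (by norm_num)))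
  rw [hc, mul_mul_mul_comm, ← ENNReal.mul_rpow_of_nonneg c _ (by norm_num),
    ← ENNReal.mul_rpow_of_nonneg c _ (by norm_num)]
  gcongr
  · exact (lintegral_nearWeight_mul_sq_le hρ _ hG).trans (by gcongr)
  · exact lintegral_nearWeight_mul_comp_smul_sq_le hρ hP

/-- The constant in the bound of the singular part of the form near `s = 1`, in dimension `d`. -/
noncomputable def nearConst (d : ℕ) : ℝ := (2 * Real.pi + 1) * (Real.pi * 2 ^ (d + 1))

lemma nearConst_pos (d : ℕ) : 0 < nearConst d := by unfold nearConst; positivity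

variable {ψ F φ : E → ℝ}

lemma ofReal_segForm_eq_integral_fourier (hψ : ContDiff ℝ ∞ ψ) (hψc : HasCompactSupport ψ)
    (hF : ContDiff ℝ ∞ F) (hFc : HasCompactSupport F) (hφ : ContDiff ℝ ∞ φ)
    (hφc : HasCompactSupport φ) {s : ℝ} (h0 : 0 < s) (hs : s < 1) :
    ((segForm s ψ F φ : ℝ) : ℂ) =
      ∫ ξ, 𝓕 (toComplexSchwartz hF hFc) ξ * 𝓕⁻ (toComplexSchwartz hψ hψc) ((1 - s) • ξ) *
        𝓕⁻ (toComplexSchwartz hφ hφc) (s • ξ) := by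
  rw [← integral_mul_integral_segment_eq_fourier, segForm_eq_integral_integral
    hψ.continuous.measurable (hψ.continuous.integrable_of_hasCompactSupport hψc)
    hF.continuous.measurable (hF.continuous.memLp_of_hasCompactSupport hFc)
    hφ.continuous.measurable (hφ.continuous.memLp_of_hasCompactSupport hφc) h0 hs,
    ← integral_complex_ofReal]
  simp only [Complex.ofReal_mul, ← integral_complex_ofReal, toComplexSchwartz_apply]

variable {c : E} {ρ A : ℝ}

lemma IsMeanZeroBump.ofReal_mul_enorm_fourierInv_le (hρ : 0 < ρ) (h : IsMeanZeroBump c ρ A ψ)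
    {s : ℝ} (hs : s < 1) (ξ : E) :
    ENNReal.ofReal (1 / (1 - s)) *
        ‖𝓕⁻ (toComplexSchwartz h.contDiff h.hasCompactSupport) ((1 - s) • ξ)‖ₑ ≤
      ENNReal.ofReal ((2 * Real.pi + 1) * A) * nearWeight ρ s ξ := by
  have ht : 0 < 1 - s := by linarith
  have hA := h.nonneg
  rw [← ofReal_norm, nearWeight, ← ENNReal.ofReal_mul (by positivity),
    ← ENNReal.ofReal_mul (by positivity)]
  refine ENNReal.ofReal_le_ofReal ?_
  grw [h.norm_fourierInv_le hρ, norm_smul, Real.norm_of_nonneg ht.le]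
  refine le_of_eq ?_
  rw [show ρ * ((1 - s) * ‖ξ‖) = ρ * ‖ξ‖ * (1 - s) by ring]
  field_simp

lemma IsMeanZeroBump.ofReal_mul_enorm_segForm_le (hρ : 0 < ρ) (h : IsMeanZeroBump c ρ A ψ)
    (hF : ContDiff ℝ ∞ F) (hFc : HasCompactSupport F) (hφ : ContDiff ℝ ∞ φ)
    (hφc : HasCompactSupport φ) {s : ℝ} (h0 : 0 < s) (hs : s < 1) :
    ENNReal.ofReal (1 / (1 - s)) * ‖segForm s ψ F φ‖ₑ ≤
      ENNReal.ofReal ((2 * Real.pi + 1) * A) * ∫⁻ ξ, nearWeight ρ s ξ *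
        (‖(𝓕 (toComplexSchwartz hF hFc) : 𝓢(E, ℂ)) ξ‖ₑ *
          ‖(𝓕⁻ (toComplexSchwartz hφ hφc) : 𝓢(E, ℂ)) (s • ξ)‖ₑ) := by
  have henorm : ‖segForm s ψ F φ‖ₑ = ‖((segForm s ψ F φ : ℝ) : ℂ)‖ₑ := by
    rw [← ofReal_norm, ← ofReal_norm, Complex.norm_real]
  rw [henorm, ofReal_segForm_eq_integral_fourier h.contDiff h.hasCompactSupport hF hFc hφ hφc h0 hs]
  grw [enorm_integral_le_lintegral_enorm]
  rw [← lintegral_const_mul' _ _ ENNReal.ofReal_ne_top,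
    ← lintegral_const_mul' _ _ ENNReal.ofReal_ne_top]
  refine lintegral_mono fun ξ => ?_
  simp only [enorm_mul]
  rw [mul_assoc, mul_left_comm ‖_‖ₑ, ← mul_assoc, ← mul_assoc (ENNReal.ofReal (_ * A))]
  exact mul_le_mul_left (h.ofReal_mul_enorm_fourierInv_le hρ hs ξ) _

lemma IsMeanZeroBump.setLIntegral_enorm_segForm_le_of_contDiff (hρ : 0 < ρ)
    (h : IsMeanZeroBump c ρ A ψ) (hF : ContDiff ℝ ∞ F) (hFc : HasCompactSupport F)
    (hφ : ContDiff ℝ ∞ φ) (hφc : HasCompactSupport φ) :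
    ∫⁻ s in Set.Ioo (1 / 2 : ℝ) 1, ENNReal.ofReal (1 / (1 - s)) * ‖segForm s ψ F φ‖ₑ ≤
      ENNReal.ofReal (nearConst (finrank ℝ E) * A) *
        (eLpNorm F 2 volume * eLpNorm φ 2 volume) := by
  have hA := h.nonneg
  refine (setLIntegral_mono' measurableSet_Ioo fun s hs => h.ofReal_mul_enorm_segForm_le hρ
    hF hFc hφ hφc (one_half_pos.trans hs.1) hs.2).trans ?_
  rw [lintegral_const_mul' _ _ ENNReal.ofReal_ne_top]
  refine (mul_le_mul_right (lintegral_nearWeight_mul_mul_comp_smul_le hρ.le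
    (𝓕 (toComplexSchwartz hF hFc)).continuous.measurable.enorm
    (𝓕⁻ (toComplexSchwartz hφ hφc)).continuous.measurable.enorm) _).trans ?_
  rw [← eLpNorm_two_eq_lintegral_enorm_sq, ← eLpNorm_two_eq_lintegral_enorm_sq, eLpNorm_fourier_eq,
    eLpNorm_fourierInv_eq, eLpNorm_toComplexSchwartz, eLpNorm_toComplexSchwartz, ← mul_assoc,
    ← ENNReal.ofReal_mul (by positivity), nearConst]
  exact le_of_eq (by congr 2; ring)

lemma exists_contDiff_hasCompactSupport_tendsto_eLpNorm_sub {p : ℝ≥0∞} (hp : p ≠ ⊤) (hp1 : 1 ≤ p)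
    (hF : MemLp F p volume) :
    ∃ G : ℕ → E → ℝ, (∀ k, ContDiff ℝ ∞ (G k)) ∧ (∀ k, HasCompactSupport (G k)) ∧
      Tendsto (fun k => eLpNorm (F - G k) p volume) atTop (𝓝 0) := by
  have hex (k : ℕ) : ∃ g : E → ℝ, HasCompactSupport g ∧ ContDiff ℝ ∞ g ∧
      eLpNorm (F - g) p volume ≤ ENNReal.ofReal (1 / ((k : ℝ) + 1)) :=
    MemLp.exist_eLpNorm_sub_le hp hp1 hF (by positivity)
  choose G hGc hG hGF using hex
  refine ⟨G, hG, hGc, tendsto_of_tendsto_of_tendsto_of_le_of_le tendsto_const_nhds ?_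
    (fun _ => zero_le) hGF⟩
  simpa using ENNReal.tendsto_ofReal tendsto_one_div_add_atTop_nhds_zero_nat

lemma measurable_segForm (hψ : Measurable ψ) (hF : Measurable F) (hφ : Measurable φ) :
    Measurable fun s => segForm s ψ F φ := by
  refine (StronglyMeasurable.integral_prod_right (f := fun (s : ℝ) (p : E × E) =>
    φ p.1 * (ψ (segEnd p.1 s p.2) * F p.2 * (1 / (1 - s) ^ finrank ℝ E)))
    (Measurable.stronglyMeasurable ?_)).measurable
  exact (hφ.comp (by fun_prop)).mul (((hψ.comp (measurable_segEnd.comp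
    (by fun_prop : Measurable fun q : ℝ × E × E => (q.2.1, q.1, q.2.2)))).mul
    (hF.comp (by fun_prop))).mul (by fun_prop))

lemma IsMeanZeroBump.setLIntegral_enorm_segForm_le (hρ : 0 < ρ) (h : IsMeanZeroBump c ρ A ψ)
    (hF : Measurable F) (hF2 : MemLp F 2 volume) (hφ : ContDiff ℝ ∞ φ)
    (hφc : HasCompactSupport φ) :
    ∫⁻ s in Set.Ioo (1 / 2 : ℝ) 1, ENNReal.ofReal (1 / (1 - s)) * ‖segForm s ψ F φ‖ₑ ≤
      ENNReal.ofReal (nearConst (finrank ℝ E) * A) *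
        (eLpNorm F 2 volume * eLpNorm φ 2 volume) := by
  obtain ⟨G, hG, hGc, hlim⟩ :=
    exists_contDiff_hasCompactSupport_tendsto_eLpNorm_sub (p := 2) (by norm_num) (by norm_num) hF2
  have hGm (k : ℕ) : Measurable (G k) := (hG k).continuous.measurable
  have hG2 (k : ℕ) : MemLp (G k) 2 volume := (hG k).continuous.memLp_of_hasCompactSupport (hGc k)
  have hψm := h.contDiff.continuous.measurable
  have hψi : Integrable ψ :=
    h.contDiff.continuous.integrable_of_hasCompactSupport h.hasCompactSupport
  have hφm := hφ.continuous.measurable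
  have hφ2 : MemLp φ 2 volume := hφ.continuous.memLp_of_hasCompactSupport hφc
  set K := ENNReal.ofReal (nearConst (finrank ℝ E) * A)
  have hpointwise (s : ℝ) (hs : s ∈ Set.Ioo (1 / 2 : ℝ) 1) :
      ENNReal.ofReal (1 / (1 - s)) * ‖segForm s ψ F φ‖ₑ ≤
        liminf (fun k => ENNReal.ofReal (1 / (1 - s)) * ‖segForm s ψ (G k) φ‖ₑ) atTop :=
    (ENNReal.Tendsto.const_mul (tendsto_segForm hψm hψi hF hF2 hGm hG2 hφm hφ2
      (one_half_pos.trans hs.1) hs.2 hlim).enorm (Or.inr ENNReal.ofReal_ne_top)).liminf_eq.ge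
  have hbound (k : ℕ) : ∫⁻ s in Set.Ioo (1 / 2 : ℝ) 1,
      ENNReal.ofReal (1 / (1 - s)) * ‖segForm s ψ (G k) φ‖ₑ ≤
        K * ((eLpNorm F 2 volume + eLpNorm (F - G k) 2 volume) * eLpNorm φ 2 volume) := by
    refine (h.setLIntegral_enorm_segForm_le_of_contDiff hρ (hG k) (hGc k) hφ hφc).trans ?_
    gcongr
    simpa using eLpNorm_sub_le hF2.1 (hF2.1.sub (hG2 k).1) one_le_two
  have hlimit : Tendsto (fun k => K *
      ((eLpNorm F 2 volume + eLpNorm (F - G k) 2 volume) * eLpNorm φ 2 volume)) atTop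
      (𝓝 (K * (eLpNorm F 2 volume * eLpNorm φ 2 volume))) := by
    have hsum := hlim.const_add (eLpNorm F 2 volume)
    rw [add_zero] at hsum
    exact ENNReal.Tendsto.const_mul (ENNReal.Tendsto.mul_const hsum (Or.inr hφ2.2.ne))
      (Or.inr ENNReal.ofReal_ne_top)
  refine (setLIntegral_mono' measurableSet_Ioo hpointwise).trans
    ((lintegral_liminf_le fun k => ?_).trans ?_)
  · exact Measurable.mul (by fun_prop) (measurable_segForm hψm (hGm k) hφm).enorm
  · exact (liminf_le_liminf (Eventually.of_forall hbound)).trans hlimit.liminf_eq.le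

end NearDiagonal

section WeakDerivative

lemma exists_inner_eq_of_norm_le {𝕜 V H : Type*} [RCLike 𝕜] [AddCommGroup V] [Module 𝕜 V]
    [NormedAddCommGroup H] [InnerProductSpace 𝕜 H] [CompleteSpace H] (ι : V →ₗ[𝕜] H)
    (Λ : V →ₗ[𝕜] 𝕜) {M : ℝ} (hM : 0 ≤ M) (h : ∀ v, ‖Λ v‖ ≤ M * ‖ι v‖) :
    ∃ G : H, ‖G‖ ≤ M ∧ ∀ v, inner 𝕜 G (ι v) = Λ v := by
  obtain ⟨σ, hσ⟩ := ι.rangeRestrict.exists_rightInverse_of_surjective ι.range_rangeRestrict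
  have hισ (w : LinearMap.range ι) : ι (σ w) = w :=
    congrArg Subtype.val (LinearMap.congr_fun hσ w)
  have hΛσ (v : V) : Λ (σ (ι.rangeRestrict v)) = Λ v := by
    have hker := h (σ (ι.rangeRestrict v) - v)
    have hιv : ι (σ (ι.rangeRestrict v)) = ι v := hισ _
    rw [map_sub, map_sub, hιv, sub_self, norm_zero, mul_zero] at hker
    exact sub_eq_zero.1 (norm_le_zero_iff.1 hker)
  let L : StrongDual 𝕜 (LinearMap.range ι) := (Λ ∘ₗ σ).mkContinuous M fun w =>
    (h (σ w)).trans_eq (by rw [hισ, Submodule.coe_norm])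
  obtain ⟨T, hTL, hT⟩ := exists_extension_norm_eq (LinearMap.range ι) L
  refine ⟨(InnerProductSpace.toDual 𝕜 H).symm T, ?_, fun v => ?_⟩
  · rw [LinearIsometryEquiv.norm_map, hT]
    exact LinearMap.mkContinuous_norm_le _ hM _
  · rw [InnerProductSpace.toDual_symm_apply]
    exact (hTL (ι.rangeRestrict v)).trans (hΛσ v)

variable {n : ℕ} {φ ψ : EuclideanSpace ℝ (Fin n) → ℝ}

lemma partialD_add (hφ : Differentiable ℝ φ) (hψ : Differentiable ℝ ψ) (j : Fin n) :
    partialD j (φ + ψ) = partialD j φ + partialD j ψ := by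
  ext x
  simp [partialD, fderiv_add (hφ x) (hψ x)]

lemma partialD_const_smul (hφ : Differentiable ℝ φ) (c : ℝ) (j : Fin n) :
    partialD j (c • φ) = c • partialD j φ := by
  ext x
  simp [partialD, fderiv_const_smul (hφ x)]

lemma contDiff_partialD (hφ : ContDiff ℝ ∞ φ) (j : Fin n) : ContDiff ℝ ∞ (partialD j φ) :=
  (hφ.fderiv_right (by simp)).clm_apply contDiff_const

lemma hasCompactSupport_partialD (hφ : HasCompactSupport φ) (j : Fin n) :
    HasCompactSupport (partialD j φ) :=
  (hφ.fderiv ℝ).comp_left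
    (g := fun L : EuclideanSpace ℝ (Fin n) →L[ℝ] ℝ => L (EuclideanSpace.single j 1)) (by simp)

lemma support_partialD_subset (φ : EuclideanSpace ℝ (Fin n) → ℝ) (j : Fin n) :
    Function.support (partialD j φ) ⊆ tsupport φ := fun x hx =>
  support_fderiv_subset ℝ fun h => hx (by simp [partialD, h])

variable {Ω : Set (EuclideanSpace ℝ (Fin n))}

/-- The test functions `C_0^∞(Ω)`. -/
def testSpace (Ω : Set (EuclideanSpace ℝ (Fin n))) :
    Submodule ℝ (EuclideanSpace ℝ (Fin n) → ℝ) where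
  carrier := {φ | ContDiff ℝ ∞ φ ∧ HasCompactSupport φ ∧ tsupport φ ⊆ Ω}
  add_mem' := fun {a b} ha hb => ⟨ha.1.add hb.1, ha.2.1.add hb.2.1,
    (tsupport_add a b).trans (Set.union_subset ha.2.2 hb.2.2)⟩
  zero_mem' := ⟨contDiff_const, HasCompactSupport.zero, by simp [tsupport]⟩
  smul_mem' := fun c φ h => ⟨contDiff_const.smul h.1, h.2.1.smul_left (f := fun _ => c),
    (tsupport_smul_subset_right (fun _ => c) φ).trans h.2.2⟩

lemma memLp_testSpace (φ : testSpace Ω) :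
    MemLp (φ : EuclideanSpace ℝ (Fin n) → ℝ) 2 (volume.restrict Ω) :=
  φ.2.1.continuous.memLp_of_hasCompactSupport φ.2.2.1

/-- The inclusion of the test functions into `L²(Ω)`. -/
noncomputable def testSpaceToLp (Ω : Set (EuclideanSpace ℝ (Fin n))) :
    testSpace Ω →ₗ[ℝ] Lp ℝ 2 (volume.restrict Ω) where
  toFun φ := (memLp_testSpace φ).toLp _
  map_add' φ ψ := MemLp.toLp_add (memLp_testSpace φ) (memLp_testSpace ψ)
  map_smul' c φ := MemLp.toLp_const_smul c (memLp_testSpace φ)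

variable {u : EuclideanSpace ℝ (Fin n) → ℝ}

/-- The functional `φ ↦ ∫_Ω u ∂_j φ`, minus the distributional derivative of `u`. -/
noncomputable def integralMulPartialD (hu : MemLp u 2 (volume.restrict Ω)) (j : Fin n) :
    testSpace Ω →ₗ[ℝ] ℝ :=
  have hdiff (φ : testSpace Ω) : Differentiable ℝ (φ : EuclideanSpace ℝ (Fin n) → ℝ) :=
    φ.2.1.differentiable (by simp)
  have hint (φ : testSpace Ω) : Integrable
      (fun x => u x * partialD j (φ : EuclideanSpace ℝ (Fin n) → ℝ) x) (volume.restrict Ω) :=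
    hu.integrable_mul (q := 2) ((contDiff_partialD φ.2.1 j).continuous.memLp_of_hasCompactSupport
      (hasCompactSupport_partialD φ.2.2.1 j))
  { toFun φ := ∫ x in Ω, u x * partialD j (φ : EuclideanSpace ℝ (Fin n) → ℝ) x
    map_add' φ ψ := by
      rw [← integral_add (hint φ) (hint ψ)]
      simp only [Submodule.coe_add, partialD_add (hdiff φ) (hdiff ψ), Pi.add_apply, mul_add]
    map_smul' c φ := by
      rw [RingHom.id_apply, smul_eq_mul, ← integral_const_mul]
      simp only [Submodule.coe_smul, partialD_const_smul (hdiff φ), Pi.smul_apply, smul_eq_mul,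
        mul_left_comm] }

lemma exists_hasWeakPartialD (hΩ : volume Ω ≠ ⊤) (j : Fin n)
    (hu : MemLp u 2 (volume.restrict Ω)) {M : ℝ} (hM : 0 ≤ M)
    (h : ∀ φ : testSpace Ω, |integralMulPartialD hu j φ| ≤ M * l2Norm Ω φ) :
    ∃ g, MemLp g 2 (volume.restrict Ω) ∧ HasWeakPartialD Ω j u g ∧ l2Norm Ω g ≤ M := by
  have : IsFiniteMeasure (volume.restrict Ω) := isFiniteMeasure_restrict.2 hΩ
  obtain ⟨G, hGM, hG⟩ := exists_inner_eq_of_norm_le (testSpaceToLp Ω) (integralMulPartialD hu j) hM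
    fun φ => (h φ).trans_eq (congrArg (M * ·) (Lp.norm_toLp _ (memLp_testSpace φ)).symm)
  have hG2 : MemLp (-G : EuclideanSpace ℝ (Fin n) → ℝ) 2 (volume.restrict Ω) := (Lp.memLp G).neg
  refine ⟨-G, hG2, ⟨IntegrableOn.locallyIntegrableOn (hu.integrable one_le_two),
    IntegrableOn.locallyIntegrableOn (hG2.integrable one_le_two), fun φ hφ hφc hφΩ => ?_⟩, ?_⟩
  · refine (hG ⟨φ, hφ, hφc, hφΩ⟩).symm.trans ?_
    rw [L2.inner_def, ← integral_neg]
    refine integral_congr_ae ?_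
    filter_upwards [(memLp_testSpace ⟨φ, hφ, hφc, hφΩ⟩).coeFn_toLp] with x hx
    simp only [testSpaceToLp, LinearMap.coe_mk, AddHom.coe_mk, hx]
    simp [mul_comm]
  · rwa [l2Norm, eLpNorm_neg, ← Lp.norm_def]

lemma exists_isH1WithGradient (hΩ : volume Ω ≠ ⊤) (hu : MemLp u 2 (volume.restrict Ω)) {M : ℝ}
    (hM : 0 ≤ M) (h : ∀ j, ∀ φ : testSpace Ω, |integralMulPartialD hu j φ| ≤ M * l2Norm Ω φ) :
    ∃ g, IsH1WithGradient Ω u g ∧ √(∑ j, l2Norm Ω (g j) ^ 2) ≤ √n * M := by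
  choose g hg2 hg hgM using fun j => exists_hasWeakPartialD hΩ j hu hM (h j)
  refine ⟨g, ⟨hu, fun j => ⟨hg2 j, hg j⟩⟩, ?_⟩
  calc √(∑ j, l2Norm Ω (g j) ^ 2) ≤ √(∑ _ : Fin n, M ^ 2) := by
        gcongr with j
        · exact ENNReal.toReal_nonneg
        · exact hgM j
    _ = √n * M := by
        rw [Finset.sum_const, Finset.card_univ, Fintype.card_fin, nsmul_eq_mul,
          Real.sqrt_mul n.cast_nonneg, Real.sqrt_sq hM]

end WeakDerivative

section Interpolation

open Module

lemma min_le_rpow_mul_rpow {a b l : ℝ} (ha : 0 < a) (hb : 0 < b) (hl0 : 0 ≤ l) (hl1 : l ≤ 1) :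
    min a b ≤ a ^ l * b ^ (1 - l) :=
  have hmin := lt_min ha hb
  calc min a b = min a b ^ l * min a b ^ (1 - l) := by
        rw [← Real.rpow_add hmin, add_sub_cancel, Real.rpow_one]
    _ ≤ a ^ l * b ^ (1 - l) := by
        gcongr
        exacts [min_le_left a b, min_le_right a b]

lemma min_inv_pow_le_rpow_mul_rpow (n : ℕ) {s V l : ℝ} (h0 : 0 < s) (hs : s < 1) (hV : 1 ≤ V)
    (hl0 : 0 ≤ l) (hl1 : l ≤ 1) :
    min (s⁻¹ ^ n) (1 / (1 - s) ^ n * V) ≤ 2 ^ n * ((s⁻¹ ^ n) ^ l * V ^ (1 - l)) := by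
  have hsn : 1 ≤ s⁻¹ ^ n := one_le_pow₀ ((one_le_inv₀ h0).2 hs.le)
  rcases le_total s (1 / 2) with h | h
  · have htwo : 1 / (1 - s) ^ n ≤ (2 : ℝ) ^ n := by
      rw [← one_div_pow]
      have : 0 < 1 - s := sub_pos.2 hs
      gcongr
      rw [div_le_iff₀ this]
      linarith
    calc min (s⁻¹ ^ n) (1 / (1 - s) ^ n * V) ≤ min (2 ^ n * s⁻¹ ^ n) (2 ^ n * V) := by
          gcongr
          exact le_mul_of_one_le_left (by positivity) (one_le_pow₀ one_le_two)
      _ = 2 ^ n * min (s⁻¹ ^ n) V := (mul_min_of_nonneg _ _ (by positivity)).symm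
      _ ≤ 2 ^ n * ((s⁻¹ ^ n) ^ l * V ^ (1 - l)) := by
          gcongr
          exact min_le_rpow_mul_rpow (by positivity) (by positivity) hl0 hl1
  · calc min (s⁻¹ ^ n) (1 / (1 - s) ^ n * V) ≤ s⁻¹ ^ n := min_le_left _ _
      _ ≤ 2 ^ n := by
          gcongr
          rw [inv_le_comm₀ h0 two_pos]
          linarith
      _ ≤ 2 ^ n * ((s⁻¹ ^ n) ^ l * V ^ (1 - l)) :=
          le_mul_of_one_le_right (by positivity) (one_le_mul_of_one_le_of_one_le
            (Real.one_le_rpow hsn hl0) (Real.one_le_rpow hV (sub_nonneg.2 hl1)))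

lemma sqrt_mul_sq_mul_rpow_mul_rpow {A a V : ℝ} (hA : 0 ≤ A) (ha : 0 ≤ a) (hV : 0 ≤ V) (l : ℝ) :
    √(A ^ 2 * (a ^ l * V ^ (1 - l))) = A * (a ^ (l / 2) * V ^ ((1 - l) / 2)) := by
  have hsq {b : ℝ} (hb : 0 ≤ b) (e : ℝ) : (b ^ (e / 2)) ^ 2 = b ^ e := by
    rw [← Real.rpow_mul_natCast hb, Nat.cast_ofNat, div_mul_cancel₀ e two_ne_zero]
  rw [← hsq ha l, ← hsq hV (1 - l), ← mul_pow, ← mul_pow, Real.sqrt_sq (by positivity)]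

variable {E : Type*} [NormedAddCommGroup E] [InnerProductSpace ℝ E] [FiniteDimensional ℝ E]
  [MeasurableSpace E] [BorelSpace E] {ψ F φ : E → ℝ} {Ω : Set E} {A ρ V l : ℝ}

lemma setLIntegral_segKernel_left_le_interpolation (hρ : 0 < ρ) (hV : 1 ≤ V)
    (hΩ : volume Ω ≤ ENNReal.ofReal (V * ρ ^ finrank ℝ E)) (hA : 0 ≤ A)
    (hl1 : ∫⁻ w, ‖ψ w‖ₑ ≤ ENNReal.ofReal A) (hlinfty : ∀ w, |ψ w| ≤ A / ρ ^ finrank ℝ E)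
    (h0 : 0 ≤ l) (h1 : l ≤ 1) {s : ℝ} (hs0 : 0 < s) (hs1 : s < 1) (y : E) :
    ∫⁻ x in Ω, segKernel ψ s x y ≤
      ENNReal.ofReal
        (A * (2 ^ finrank ℝ E * ((s⁻¹ ^ finrank ℝ E) ^ l * V ^ (1 - l)))) := by
  have : 0 < 1 - s := by linarith
  have hleft : ∫⁻ x in Ω, segKernel ψ s x y ≤ ENNReal.ofReal (A * s⁻¹ ^ finrank ℝ E) := by
    refine (setLIntegral_le_lintegral _ _).trans ?_
    rw [lintegral_segKernel_left ψ hs0 hs1, mul_comm, ENNReal.ofReal_mul hA]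
    gcongr
  have hright : ∫⁻ x in Ω, segKernel ψ s x y ≤
      ENNReal.ofReal (A * (1 / (1 - s) ^ finrank ℝ E * V)) :=
    calc ∫⁻ x in Ω, segKernel ψ s x y
        ≤ ENNReal.ofReal (A / ρ ^ finrank ℝ E) * ENNReal.ofReal (1 / (1 - s) ^ finrank ℝ E) *
            volume Ω := setLIntegral_segKernel_left_le hlinfty Ω s y
      _ ≤ ENNReal.ofReal (A / ρ ^ finrank ℝ E) * ENNReal.ofReal (1 / (1 - s) ^ finrank ℝ E) *
            ENNReal.ofReal (V * ρ ^ finrank ℝ E) := by gcongr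
      _ = ENNReal.ofReal (A * (1 / (1 - s) ^ finrank ℝ E * V)) := by
          rw [← ENNReal.ofReal_mul (by positivity), ← ENNReal.ofReal_mul (by positivity)]
          congr 1
          field_simp
  calc ∫⁻ x in Ω, segKernel ψ s x y
      ≤ min (ENNReal.ofReal (A * s⁻¹ ^ finrank ℝ E))
          (ENNReal.ofReal (A * (1 / (1 - s) ^ finrank ℝ E * V))) := le_min hleft hright
    _ = ENNReal.ofReal (A * min (s⁻¹ ^ finrank ℝ E) (1 / (1 - s) ^ finrank ℝ E * V)) := by
        rw [mul_min_of_nonneg _ _ hA, ENNReal.ofReal_min]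
    _ ≤ _ := by
        gcongr
        exact min_inv_pow_le_rpow_mul_rpow _ hs0 hs1 hV h0 h1

lemma enorm_segForm_le_interpolation (hψ : Measurable ψ) (hF : Measurable F) (hφ : Measurable φ)
    (hφΩ : Function.support φ ⊆ Ω) (hρ : 0 < ρ) (hV : 1 ≤ V)
    (hΩ : volume Ω ≤ ENNReal.ofReal (V * ρ ^ finrank ℝ E)) (hA : 0 ≤ A)
    (hl1 : ∫⁻ w, ‖ψ w‖ₑ ≤ ENNReal.ofReal A) (hlinfty : ∀ w, |ψ w| ≤ A / ρ ^ finrank ℝ E)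
    (h0 : 0 ≤ l) (h1 : l ≤ 1) {s : ℝ} (hs0 : 0 < s) (hs1 : s < 1) :
    ‖segForm s ψ F φ‖ₑ ≤
      ENNReal.ofReal (A * (2 ^ finrank ℝ E *
          ((s⁻¹ ^ finrank ℝ E) ^ (l / 2) * V ^ ((1 - l) / 2)))) *
        (eLpNorm F 2 volume * eLpNorm φ 2 volume) := by
  refine (enorm_segForm_le hψ hF hφ hφΩ hs1 (setLIntegral_segKernel_left_le_interpolation hρ hV hΩ
    hA hl1 hlinfty h0 h1 hs0 hs1)).trans ?_
  gcongr
  set a := s⁻¹ ^ finrank ℝ E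
  set b : ℝ := 2 ^ finrank ℝ E
  have hb : b ≤ b ^ 2 := le_self_pow₀ (one_le_pow₀ one_le_two) two_ne_zero
  calc ((∫⁻ w, ‖ψ w‖ₑ) * ENNReal.ofReal (A * (b * (a ^ l * V ^ (1 - l))))) ^ (1 / 2 : ℝ)
      ≤ (ENNReal.ofReal A * ENNReal.ofReal (A * (b * (a ^ l * V ^ (1 - l))))) ^ (1 / 2 : ℝ) := by
        gcongr
    _ = ENNReal.ofReal √(A * (A * (b * (a ^ l * V ^ (1 - l))))) := by
        rw [← ENNReal.ofReal_mul hA,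
          ENNReal.ofReal_rpow_of_nonneg (by positivity) one_half_pos.le, ← Real.sqrt_eq_rpow]
    _ ≤ ENNReal.ofReal √((A * b) ^ 2 * (a ^ l * V ^ (1 - l))) := by
        gcongr ENNReal.ofReal √?_
        calc A * (A * (b * (a ^ l * V ^ (1 - l)))) = A ^ 2 * b * (a ^ l * V ^ (1 - l)) := by ring
          _ ≤ A ^ 2 * b ^ 2 * (a ^ l * V ^ (1 - l)) := by gcongr
          _ = (A * b) ^ 2 * (a ^ l * V ^ (1 - l)) := by ring
    _ = ENNReal.ofReal (A * (b * (a ^ (l / 2) * V ^ ((1 - l) / 2)))) := by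
        rw [sqrt_mul_sq_mul_rpow_mul_rpow (by positivity) (by positivity) (by positivity),
          mul_assoc]

/-- The `s`-integral of the weight `s^(ℓ-1)` against the geometric mean, with exponent `l`, of the
two Schur bounds for `segForm s` on a set of relative volume `V`. -/
noncomputable def interpolationIntegral (n ℓ : ℕ) (V l : ℝ) : ℝ≥0∞ :=
  ∫⁻ s in Set.Ioo (0 : ℝ) 1,
    ENNReal.ofReal (s ^ (ℓ - 1) * ((s⁻¹ ^ n) ^ (l / 2) * V ^ ((1 - l) / 2)))

lemma lintegral_pow_mul_enorm_segForm_le (ℓ : ℕ) (hψ : Measurable ψ) (hF : Measurable F)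
    (hφ : Measurable φ) (hφΩ : Function.support φ ⊆ Ω) (hρ : 0 < ρ) (hV : 1 ≤ V)
    (hΩ : volume Ω ≤ ENNReal.ofReal (V * ρ ^ finrank ℝ E)) (hA : 0 ≤ A)
    (hl1 : ∫⁻ w, ‖ψ w‖ₑ ≤ ENNReal.ofReal A) (hlinfty : ∀ w, |ψ w| ≤ A / ρ ^ finrank ℝ E)
    (h0 : 0 ≤ l) (h1 : l ≤ 1) :
    ∫⁻ s in Set.Ioo (0 : ℝ) 1, ENNReal.ofReal (s ^ (ℓ - 1)) * ‖segForm s ψ F φ‖ₑ ≤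
      ENNReal.ofReal A * (2 ^ finrank ℝ E * interpolationIntegral (finrank ℝ E) ℓ V l) *
        (eLpNorm F 2 volume * eLpNorm φ 2 volume) := by
  set N := eLpNorm F 2 volume * eLpNorm φ 2 volume
  calc ∫⁻ s in Set.Ioo (0 : ℝ) 1, ENNReal.ofReal (s ^ (ℓ - 1)) * ‖segForm s ψ F φ‖ₑ
      ≤ ∫⁻ s in Set.Ioo (0 : ℝ) 1, ENNReal.ofReal A * 2 ^ finrank ℝ E * N * ENNReal.ofReal
          (s ^ (ℓ - 1) * ((s⁻¹ ^ finrank ℝ E) ^ (l / 2) * V ^ ((1 - l) / 2))) := by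
        refine setLIntegral_mono (by fun_prop) fun s hs => ?_
        have : 0 < s := hs.1
        grw [enorm_segForm_le_interpolation hψ hF hφ hφΩ hρ hV hΩ hA hl1 hlinfty h0 h1 hs.1 hs.2]
        rw [ENNReal.ofReal_mul hA, ENNReal.ofReal_mul (by positivity),
          ENNReal.ofReal_mul (p := s ^ (ℓ - 1)) (by positivity),
          ENNReal.ofReal_pow zero_le_two, ENNReal.ofReal_ofNat]
        exact le_of_eq (by ring)
    _ = ENNReal.ofReal A * 2 ^ finrank ℝ E * N * interpolationIntegral (finrank ℝ E) ℓ V l :=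
        lintegral_const_mul _ (by fun_prop)
    _ = _ := by ring

lemma IsMeanZeroBump.lintegral_enorm_le {c : E} (h : IsMeanZeroBump c ρ A ψ) :
    ∫⁻ w, ‖ψ w‖ₑ ≤ ENNReal.ofReal A := by
  rw [← ofReal_integral_norm_eq_lintegral_enorm
    (h.contDiff.continuous.integrable_of_hasCompactSupport h.hasCompactSupport)]
  exact ENNReal.ofReal_le_ofReal h.l1_bound

lemma IsMeanZeroBump.lintegral_singular_mul_enorm_segForm_le {c : E} (ℓ : ℕ)
    (h : IsMeanZeroBump c ρ A ψ) (hF : Measurable F) (hF2 : MemLp F 2 volume)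
    (hφ : ContDiff ℝ ∞ φ) (hφc : HasCompactSupport φ) (hφΩ : Function.support φ ⊆ Ω)
    (hρ : 0 < ρ) (hV : 1 ≤ V) (hΩ : volume Ω ≤ ENNReal.ofReal (V * ρ ^ finrank ℝ E))
    (h0 : 0 ≤ l) (h1 : l ≤ 1) :
    ∫⁻ s in Set.Ioo (0 : ℝ) 1,
        ENNReal.ofReal (s ^ (ℓ - 1) * (s / (1 - s))) * ‖segForm s ψ F φ‖ₑ ≤
      ENNReal.ofReal A * (2 ^ finrank ℝ E * interpolationIntegral (finrank ℝ E) ℓ V l +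
        ENNReal.ofReal (nearConst (finrank ℝ E))) *
          (eLpNorm F 2 volume * eLpNorm φ 2 volume) := by
  have hψm := h.contDiff.continuous.measurable
  have hφm := hφ.continuous.measurable
  have hm : Measurable fun s => ‖segForm s ψ F φ‖ₑ := (measurable_segForm hψm hF hφm).enorm
  have hfar : ∫⁻ s in Set.Ioc (0 : ℝ) (1 / 2),
      ENNReal.ofReal (s ^ (ℓ - 1) * (s / (1 - s))) * ‖segForm s ψ F φ‖ₑ ≤
      ∫⁻ s in Set.Ioo (0 : ℝ) 1, ENNReal.ofReal (s ^ (ℓ - 1)) * ‖segForm s ψ F φ‖ₑ := by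
    refine (setLIntegral_mono (by fun_prop) fun s hs => ?_).trans
      (lintegral_mono_set fun s hs => ⟨hs.1, hs.2.trans_lt one_half_lt_one⟩)
    have : 0 < s := hs.1
    gcongr
    refine mul_le_of_le_one_right (by positivity) ?_
    rw [div_le_one] <;> linarith [hs.2]
  have hnear : ∫⁻ s in Set.Ioo (1 / 2 : ℝ) 1,
      ENNReal.ofReal (s ^ (ℓ - 1) * (s / (1 - s))) * ‖segForm s ψ F φ‖ₑ ≤
      ∫⁻ s in Set.Ioo (1 / 2 : ℝ) 1, ENNReal.ofReal (1 / (1 - s)) * ‖segForm s ψ F φ‖ₑ := by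
    refine setLIntegral_mono (by fun_prop) fun s hs => ?_
    have hs0 : 0 < s := by linarith [hs.1]
    have : 0 < 1 - s := by linarith [hs.2]
    rw [← mul_div_assoc, ← pow_succ]
    gcongr
    exact pow_le_one₀ hs0.le hs.2.le
  rw [← Set.Ioc_union_Ioo_eq_Ioo (one_half_pos (α := ℝ)).le one_half_lt_one]
  refine (lintegral_union_le _ _ _).trans ?_
  grw [hfar, hnear, lintegral_pow_mul_enorm_segForm_le ℓ hψm hF hφm hφΩ hρ hV hΩ h.nonneg
    h.lintegral_enorm_le h.linfty_bound h0 h1, h.setLIntegral_enorm_segForm_le hρ hF hF2 hφ hφc,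
    ENNReal.ofReal_mul (nearConst_pos _).le]
  exact le_of_eq (by ring)

end Interpolation

section Kappa

lemma lintegral_rpow_sub_one_Ioo {a : ℝ} (ha : 0 < a) :
    ∫⁻ s in Set.Ioo (0 : ℝ) 1, ENNReal.ofReal (s ^ (a - 1)) = ENNReal.ofReal (1 / a) := by
  have hint : IntegrableOn (fun s : ℝ => s ^ (a - 1)) (Set.Ioo 0 1) :=
    (intervalIntegrable_iff_integrableOn_Ioo_of_le zero_le_one).1
      (intervalIntegral.intervalIntegrable_rpow' (by linarith))
  rw [← ofReal_integral_eq_lintegral_ofReal hint ((ae_restrict_iff' measurableSet_Ioo).2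
      (ae_of_all _ fun s hs => Real.rpow_nonneg hs.1.le _)),
    ← integral_Ioc_eq_integral_Ioo, ← intervalIntegral.integral_of_le zero_le_one,
    integral_rpow (Or.inl (by linarith))]
  simp [ha.ne']

variable {n ℓ : ℕ} {V : ℝ}

lemma interpolationIntegral_eq (hℓ : 1 ≤ ℓ) {l : ℝ}
    (h : 0 < (ℓ : ℝ) - n * (l / 2)) :
    interpolationIntegral n ℓ V l =
      ENNReal.ofReal (1 / (ℓ - n * (l / 2)) * V ^ ((1 - l) / 2)) := by
  rw [interpolationIntegral, ENNReal.ofReal_mul (by positivity), ← lintegral_rpow_sub_one_Ioo h,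
    ← lintegral_mul_const' _ _ ENNReal.ofReal_ne_top]
  refine setLIntegral_congr_fun measurableSet_Ioo fun s hs => ?_
  have hs0 : 0 < s := hs.1
  have hpow : s ^ (ℓ - 1) * (s⁻¹ ^ n) ^ (l / 2) = s ^ ((ℓ : ℝ) - n * (l / 2) - 1) := by
    rw [← Real.rpow_natCast s⁻¹ n, ← Real.rpow_mul (by positivity), Real.inv_rpow hs0.le,
      ← Real.rpow_neg hs0.le, ← Real.rpow_natCast s, ← Real.rpow_add hs0, Nat.cast_sub hℓ]
    congr 1
    push_cast
    ring
  rw [← mul_assoc, hpow, ENNReal.ofReal_mul (by positivity)]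

lemma one_le_kappa (n ℓ : ℕ) (hV : 1 ≤ V) : 1 ≤ kappa n ℓ V := by
  have := Real.log_nonneg hV
  unfold kappa
  split_ifs
  · exact le_rfl
  all_goals exact le_add_of_nonneg_right (by positivity)

lemma interpolationIntegral_one_le (hℓ : 1 ≤ ℓ) (hn : n < 2 * ℓ) (V : ℝ) :
    interpolationIntegral n ℓ V 1 ≤ ENNReal.ofReal (1 / (ℓ - n / 2) * kappa n ℓ V) := by
  have hn' : (n : ℝ) < 2 * ℓ := mod_cast hn
  rw [interpolationIntegral_eq hℓ (by linarith), kappa, if_pos hn]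
  simp [div_eq_mul_inv]

lemma kappa_eq_one_add_log (hℓ : 1 ≤ ℓ) (V : ℝ) : kappa (2 * ℓ) ℓ V = 1 + Real.log V := by
  have : (ℓ : ℝ) ≠ 0 := by positivity
  have hexp : ((2 * ℓ : ℕ) : ℝ) / (2 * ((2 * ℓ : ℕ) - ℓ)) = 1 := by
    push_cast
    field_simp
    ring
  rw [kappa, if_neg (lt_irrefl _), if_pos (Or.inr rfl), hexp]
  simp

-- At `n = 2ℓ` the choice `l = 1` makes the integral diverge logarithmically; moving `l` away from
-- `1` by `1 / (1 + log V)` turns the divergence into the factor `1 + log V` and costs at most `e`.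
lemma interpolationIntegral_le_of_eq_two_mul (hℓ : 1 ≤ ℓ) (hV : 1 ≤ V) :
    interpolationIntegral (2 * ℓ) ℓ V (1 - (1 + Real.log V)⁻¹) ≤
      ENNReal.ofReal (Real.exp 1 * kappa (2 * ℓ) ℓ V) := by
  have hlog := Real.log_nonneg hV
  set L := 1 + Real.log V
  have hL0 : 0 < L := by positivity
  have hexponent : (ℓ : ℝ) - (2 * ℓ : ℕ) * ((1 - L⁻¹) / 2) = ℓ * L⁻¹ := by
    push_cast
    ring
  rw [interpolationIntegral_eq hℓ (by rw [hexponent]; positivity), hexponent,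
    kappa_eq_one_add_log hℓ, sub_sub_cancel, mul_comm]
  have hpow : V ^ (L⁻¹ / 2) ≤ Real.exp 1 := by
    rw [Real.rpow_def_of_pos (by positivity), Real.exp_le_exp]
    have : Real.log V * L⁻¹ ≤ 1 := by
      rw [← div_eq_mul_inv, div_le_one hL0]
      linarith
    linarith
  have hinv : 1 / (ℓ * L⁻¹) ≤ L := by
    rw [one_div, mul_inv, inv_inv]
    exact mul_le_of_le_one_left hL0.le (inv_le_one_of_one_le₀ (mod_cast hℓ))
  gcongr

lemma rpow_le_exp_one_mul_one_add_rpow_mul_log_rpow (hV : 1 ≤ V) {a b : ℝ} (ha : a ≤ 1)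
    (hb : 0 ≤ b) : V ^ a ≤ Real.exp 1 * (1 + V ^ a * Real.log V ^ b) := by
  have := Real.log_nonneg hV
  rcases le_total 1 (Real.log V) with hlog | hlog
  · calc V ^ a ≤ V ^ a * Real.log V ^ b :=
          le_mul_of_one_le_right (by positivity) (Real.one_le_rpow hlog hb)
      _ ≤ 1 + V ^ a * Real.log V ^ b := le_add_of_nonneg_left zero_le_one
      _ ≤ Real.exp 1 * (1 + V ^ a * Real.log V ^ b) :=
          le_mul_of_one_le_left (by positivity) (Real.one_le_exp zero_le_one)
  · calc V ^ a ≤ V ^ (1 : ℝ) := Real.rpow_le_rpow_of_exponent_le hV ha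
      _ = V := Real.rpow_one V
      _ ≤ Real.exp 1 := (Real.log_le_iff_le_exp (by positivity)).1 hlog
      _ ≤ Real.exp 1 * (1 + V ^ a * Real.log V ^ b) :=
          le_mul_of_one_le_right (by positivity) (le_add_of_nonneg_right (by positivity))

lemma rpow_le_exp_one_mul_kappa (hn : 2 * ℓ < n) (hV : 1 ≤ V) :
    V ^ (((n : ℝ) - 2 * ℓ) / (2 * ((n : ℝ) - ℓ))) ≤ Real.exp 1 * kappa n ℓ V := by
  have hnl : (ℓ : ℝ) + 1 ≤ n := mod_cast (by omega : ℓ + 1 ≤ n)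
  have hexponent : ((n : ℝ) - 2 * ℓ) / (2 * ((n : ℝ) - ℓ)) ≤ 1 := by
    rw [div_le_one] <;> linarith [(Nat.cast_nonneg n : (0 : ℝ) ≤ n)]
  rw [kappa, if_neg (by omega)]
  split_ifs
  all_goals
    exact rpow_le_exp_one_mul_one_add_rpow_mul_log_rpow hV hexponent
      (div_nonneg n.cast_nonneg (by linarith))

lemma interpolationIntegral_le_of_two_mul_lt (hℓ : 1 ≤ ℓ) (hn : 2 * ℓ < n) (hV : 1 ≤ V) :
    interpolationIntegral n ℓ V (ℓ / (n - ℓ)) ≤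
      ENNReal.ofReal (Real.exp 1 * (2 * (n - ℓ) / (ℓ * (n - 2 * ℓ))) * kappa n ℓ V) := by
  have hℓ0 : (0 : ℝ) < ℓ := by positivity
  have hnl : 0 < (n : ℝ) - 2 * ℓ := sub_pos.2 (mod_cast hn)
  have hnl' : 0 < (n : ℝ) - ℓ := by linarith
  have hexponent : (ℓ : ℝ) - n * (ℓ / (n - ℓ) / 2) = ℓ * (n - 2 * ℓ) / (2 * (n - ℓ)) := by
    field_simp
    ring
  have hVexponent : (1 - (ℓ : ℝ) / (n - ℓ)) / 2 = (n - 2 * ℓ) / (2 * (n - ℓ)) := by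
    field_simp
    ring
  rw [interpolationIntegral_eq hℓ (by rw [hexponent]; positivity), hexponent,
    hVexponent, one_div_div, mul_right_comm, mul_comm (_ / _)]
  gcongr
  exact rpow_le_exp_one_mul_kappa hn hV

lemma exists_interpolationIntegral_le_kappa (n : ℕ) (hℓ : 1 ≤ ℓ) :
    ∃ C : ℝ, 0 < C ∧ ∀ V : ℝ, 1 ≤ V → ∃ l : ℝ, 0 ≤ l ∧ l ≤ 1 ∧
      interpolationIntegral n ℓ V l ≤ ENNReal.ofReal (C * kappa n ℓ V) := by
  rcases lt_trichotomy n (2 * ℓ) with hn | rfl | hn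
  · have : (n : ℝ) < 2 * ℓ := mod_cast hn
    exact ⟨1 / (ℓ - n / 2), one_div_pos.2 (by linarith), fun V _ => ⟨1, zero_le_one, le_rfl,
      interpolationIntegral_one_le hℓ hn V⟩⟩
  · refine ⟨Real.exp 1, Real.exp_pos 1, fun V hV => ⟨1 - (1 + Real.log V)⁻¹, ?_, ?_,
      interpolationIntegral_le_of_eq_two_mul hℓ hV⟩⟩
    · exact sub_nonneg.2 (inv_le_one_of_one_le₀ (le_add_of_nonneg_right (Real.log_nonneg hV)))
    · exact sub_le_self _ (inv_nonneg.2 (add_nonneg zero_le_one (Real.log_nonneg hV)))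
  · have hn' : 2 * (ℓ : ℝ) < n := mod_cast hn
    have hℓ0 : (0 : ℝ) < ℓ := by positivity
    have : 0 < (n : ℝ) - 2 * ℓ := by linarith
    have : 0 < (n : ℝ) - ℓ := by linarith
    exact ⟨_, by positivity, fun V hV => ⟨ℓ / (n - ℓ), by positivity,
      (div_le_one (by positivity)).2 (by linarith),
      interpolationIntegral_le_of_two_mul_lt hℓ hn hV⟩⟩

end Kappa

section Bumps

variable {n : ℕ} {g : EuclideanSpace ℝ (Fin n) → ℝ}

lemma integral_partialD_eq_zero (hg : ContDiff ℝ ∞ g) (hgc : HasCompactSupport g) (j : Fin n) :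
    ∫ x, partialD j g x = 0 := by
  have hint : Integrable (partialD j g) :=
    (contDiff_partialD hg j).continuous.integrable_of_hasCompactSupport
      (hasCompactSupport_partialD hgc j)
  have hparts := integral_mul_fderiv_eq_neg_fderiv_mul_of_integrable (𝕜 := ℝ) (μ := volume)
    (f := fun _ : EuclideanSpace ℝ (Fin n) => (1 : ℝ)) (g := g)
    (v := EuclideanSpace.single j (1 : ℝ)) (by simp)
    (by simp only [one_mul]; exact hint)
    (by simpa using hg.continuous.integrable_of_hasCompactSupport hgc) (fun x _ => by fun_prop)
    (fun x _ => hg.differentiable (by simp) x)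
  simpa [partialD] using hparts

lemma norm_fderiv_le_sum_abs_partialD (g : EuclideanSpace ℝ (Fin n) → ℝ)
    (x : EuclideanSpace ℝ (Fin n)) : ‖fderiv ℝ g x‖ ≤ ∑ k, |partialD k g x| := by
  refine ContinuousLinearMap.opNorm_le_bound _ (by positivity) fun v => ?_
  calc ‖fderiv ℝ g x v‖ = ‖∑ k, v k * partialD k g x‖ := by
        conv_lhs => rw [← (EuclideanSpace.basisFun (Fin n) ℝ).sum_repr v, map_sum]
        simp [partialD]
    _ ≤ ∑ k, ‖v k * partialD k g x‖ := norm_sum_le _ _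
    _ ≤ ∑ k, |partialD k g x| * ‖v‖ := by
        gcongr with k
        rw [norm_mul, Real.norm_eq_abs (partialD k g x), mul_comm]
        gcongr
        exact PiLp.norm_apply_le v k
    _ = (∑ k, |partialD k g x|) * ‖v‖ := (Finset.sum_mul ..).symm

lemma abs_coord_sub_le (x y : EuclideanSpace ℝ (Fin n)) (m : Fin n) : |x m - y m| ≤ ‖x - y‖ := by
  simpa using PiLp.norm_apply_le (x - y) m

lemma contDiff_coord_sub_mul (hg : ContDiff ℝ ∞ g) (m : Fin n) (a : ℝ) :
    ContDiff ℝ ∞ fun w : EuclideanSpace ℝ (Fin n) => (w m - a) * g w :=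
  ((EuclideanSpace.proj m : EuclideanSpace ℝ (Fin n) →L[ℝ] ℝ).contDiff.sub contDiff_const).mul hg

lemma hasCompactSupport_coord_sub_mul (hg : HasCompactSupport g) (m : Fin n) (a : ℝ) :
    HasCompactSupport fun w : EuclideanSpace ℝ (Fin n) => (w m - a) * g w :=
  hg.mul_left (f := fun w : EuclideanSpace ℝ (Fin n) => w m - a)

lemma partialD_coord_sub_mul (hg : Differentiable ℝ g) (k m : Fin n) (a : ℝ)
    (x : EuclideanSpace ℝ (Fin n)) :
    partialD k (fun w : EuclideanSpace ℝ (Fin n) => (w m - a) * g w) x =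
      (if k = m then g x else 0) + (x m - a) * partialD k g x := by
  have hcoord : HasFDerivAt (fun w : EuclideanSpace ℝ (Fin n) => w m - a)
      (EuclideanSpace.proj m : EuclideanSpace ℝ (Fin n) →L[ℝ] ℝ) x :=
    (EuclideanSpace.proj m : EuclideanSpace ℝ (Fin n) →L[ℝ] ℝ).hasFDerivAt.sub_const a
  have hproduct : HasFDerivAt (fun w : EuclideanSpace ℝ (Fin n) => (w m - a) * g w) _ x :=
    hcoord.mul (hg x).hasFDerivAt
  rw [partialD, hproduct.fderiv, partialD]
  rcases eq_or_ne k m with rfl | hkm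
  · simp [add_comm]
  · simp [hkm, hkm.symm]

variable {c : EuclideanSpace ℝ (Fin n)} {ρ A : ℝ}

lemma abs_partialD_coord_sub_mul_le (hg : Differentiable ℝ g)
    (hsupp : tsupport g ⊆ Metric.closedBall c ρ) (j m : Fin n) (x : EuclideanSpace ℝ (Fin n)) :
    |partialD j (fun w => (w m - c m) * g w) x| ≤ |g x| + ρ * |partialD j g x| := by
  rw [partialD_coord_sub_mul hg]
  refine (abs_add_le _ _).trans (add_le_add ?_ ?_)
  · split_ifs <;> simp
  · rw [abs_mul]
    by_cases hx : x ∈ Metric.closedBall c ρ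
    · gcongr
      exact (abs_coord_sub_le x c m).trans (mem_closedBall_iff_norm.1 hx)
    · have : partialD j g x = 0 :=
        Function.notMem_support.1 fun h => hx (hsupp (support_partialD_subset g j h))
      simp [this]

lemma integrable_partialD (hg : ContDiff ℝ ∞ g) (hgc : HasCompactSupport g) (j : Fin n) :
    Integrable (partialD j g) :=
  (contDiff_partialD hg j).continuous.integrable_of_hasCompactSupport
    (hasCompactSupport_partialD hgc j)

lemma isMeanZeroBump_partialD (hg : ContDiff ℝ ∞ g) (hgc : HasCompactSupport g)
    (hsupp : tsupport g ⊆ Metric.closedBall c ρ) (hρ : 0 ≤ ρ) {j : Fin n}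
    (hl1 : ∫ x, |partialD j g x| ≤ A)
    (hl1' : ∀ k, ∫ x, |partialD k (partialD j g) x| ≤ A / ρ)
    (hlinfty : ∀ x, |partialD j g x| ≤ A / ρ ^ n) :
    IsMeanZeroBump c ρ (n * A) (partialD j g) := by
  have hn : (1 : ℝ) ≤ n := mod_cast j.pos
  have hA : 0 ≤ A := (integral_nonneg fun _ => abs_nonneg _).trans hl1
  have hj := contDiff_partialD hg j
  have hjc := hasCompactSupport_partialD hgc j
  have hAn : A ≤ n * A := le_mul_of_one_le_left hA hn
  refine ⟨hj, hjc, (support_partialD_subset g j).trans hsupp, integral_partialD_eq_zero hg hgc j,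
    hl1.trans hAn, ?_, fun x => (hlinfty x).trans ?_⟩
  · calc ∫ x, ‖fderiv ℝ (partialD j g) x‖ ≤ ∫ x, ∑ k, |partialD k (partialD j g) x| :=
          integral_mono_of_nonneg (ae_of_all _ fun _ => norm_nonneg _)
            (integrable_finsetSum _ fun k _ => (integrable_partialD hj hjc k).abs)
            (ae_of_all _ (norm_fderiv_le_sum_abs_partialD _))
      _ = ∑ k, ∫ x, |partialD k (partialD j g) x| :=
          integral_finsetSum _ fun k _ => (integrable_partialD hj hjc k).abs
      _ ≤ ∑ _ : Fin n, A / ρ := Finset.sum_le_sum fun k _ => hl1' k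
      _ = n * A / ρ := by simp [mul_div_assoc]
  · rw [finrank_euclideanSpace_fin]
    gcongr

/-- A test function supported in `B` whose derivatives of order at most two obey the bounds of an
amplitude-`A` bump at scale `ρ`. Only finitely many of the constants `K_α` enter the estimates, and
they enter through the single number `A`. -/
structure IsBumpOfSize (B : Set (EuclideanSpace ℝ (Fin n))) (ρ A : ℝ)
    (θ : EuclideanSpace ℝ (Fin n) → ℝ) : Prop where
  contDiff : ContDiff ℝ ∞ θ
  hasCompactSupport : HasCompactSupport θ
  tsupport_subset : tsupport θ ⊆ B
  l1_bound : ∫ x, |θ x| ≤ A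
  l1_partialD_bound : ∀ j, ∫ x, |partialD j θ x| ≤ A / ρ
  l1_partialD_partialD_bound : ∀ k j, ∫ x, |partialD k (partialD j θ) x| ≤ A / ρ ^ 2
  linfty_bound : ∀ x, |θ x| ≤ A / ρ ^ n
  linfty_partialD_bound : ∀ j x, |partialD j θ x| ≤ A / ρ ^ (n + 1)

namespace IsBumpOfSize

variable {B : Set (EuclideanSpace ℝ (Fin n))} {θ : EuclideanSpace ℝ (Fin n) → ℝ}

lemma nonneg (h : IsBumpOfSize B ρ A θ) : 0 ≤ A :=
  (integral_nonneg fun _ => abs_nonneg _).trans h.l1_bound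

lemma measurable (h : IsBumpOfSize B ρ A θ) : Measurable θ := h.contDiff.continuous.measurable

lemma integrable (h : IsBumpOfSize B ρ A θ) : Integrable θ :=
  h.contDiff.continuous.integrable_of_hasCompactSupport h.hasCompactSupport

lemma lintegral_enorm_le (h : IsBumpOfSize B ρ A θ) : ∫⁻ w, ‖θ w‖ₑ ≤ ENNReal.ofReal A := by
  rw [← ofReal_integral_norm_eq_lintegral_enorm h.integrable]
  exact ENNReal.ofReal_le_ofReal h.l1_bound

lemma isMeanZeroBump_partialD (h : IsBumpOfSize B ρ A θ) (hB : B ⊆ Metric.closedBall c ρ)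
    (hρ : 0 < ρ) (j : Fin n) : IsMeanZeroBump c ρ (n * (A / ρ)) (partialD j θ) :=
  _root_.isMeanZeroBump_partialD h.contDiff h.hasCompactSupport (h.tsupport_subset.trans hB) hρ.le
    (h.l1_partialD_bound j)
    (fun k => (h.l1_partialD_partialD_bound k j).trans_eq (by rw [div_div, sq]))
    fun x => (h.linfty_partialD_bound j x).trans_eq (by rw [div_div, pow_succ'])

lemma integral_abs_partialD_coord_sub_mul_le (h : IsBumpOfSize B ρ A θ)
    (hB : B ⊆ Metric.closedBall c ρ) (hρ : 0 < ρ) (j m : Fin n) :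
    ∫ x, |partialD j (fun w => (w m - c m) * θ w) x| ≤ 3 * A := by
  have hj := integrable_partialD h.contDiff h.hasCompactSupport j
  calc ∫ x, |partialD j (fun w => (w m - c m) * θ w) x|
      ≤ ∫ x, (|θ x| + ρ * |partialD j θ x|) :=
        integral_mono_of_nonneg (ae_of_all _ fun _ => abs_nonneg _)
          (h.integrable.abs.add (hj.abs.const_mul ρ))
          (ae_of_all _ (abs_partialD_coord_sub_mul_le (h.contDiff.differentiable (by simp))
            (h.tsupport_subset.trans hB) j m))
    _ = (∫ x, |θ x|) + ρ * ∫ x, |partialD j θ x| := by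
        rw [integral_add h.integrable.abs (hj.abs.const_mul ρ), integral_const_mul]
    _ ≤ A + ρ * (A / ρ) := by
        gcongr
        exacts [h.l1_bound, h.l1_partialD_bound j]
    _ ≤ 3 * A := by
        rw [mul_div_cancel₀ _ hρ.ne']
        linarith [h.nonneg]

lemma abs_partialD_partialD_coord_sub_mul_le (h : IsBumpOfSize B ρ A θ)
    (hB : B ⊆ Metric.closedBall c ρ) (k j m : Fin n) (x : EuclideanSpace ℝ (Fin n)) :
    |partialD k (partialD j fun w => (w m - c m) * θ w) x| ≤
      |partialD k θ x| + (|partialD j θ x| + ρ * |partialD k (partialD j θ) x|) := by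
  have hθ : Differentiable ℝ θ := h.contDiff.differentiable (by simp)
  have hj := contDiff_partialD h.contDiff j
  have hjsupp : tsupport (partialD j θ) ⊆ Metric.closedBall c ρ :=
    (closure_minimal (support_partialD_subset θ j) (isClosed_tsupport θ)).trans
      (h.tsupport_subset.trans hB)
  have hproduct : (partialD j fun w => (w m - c m) * θ w) =
      ((if j = m then 1 else 0 : ℝ) • θ) + fun w => (w m - c m) * partialD j θ w := by
    ext w
    rw [partialD_coord_sub_mul hθ]
    split_ifs <;> simp [*]
  rw [hproduct, partialD_add (hθ.const_smul _)
    ((contDiff_coord_sub_mul hj m _).differentiable (by simp)), partialD_const_smul hθ]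
  refine (abs_add_le _ _).trans (add_le_add ?_
    (abs_partialD_coord_sub_mul_le (hj.differentiable (by simp)) hjsupp k m x))
  split_ifs <;> simp

lemma integral_abs_partialD_partialD_coord_sub_mul_le (h : IsBumpOfSize B ρ A θ)
    (hB : B ⊆ Metric.closedBall c ρ) (hρ : 0 < ρ) (k j m : Fin n) :
    ∫ x, |partialD k (partialD j fun w => (w m - c m) * θ w) x| ≤ 3 * A / ρ := by
  have hk := (integrable_partialD h.contDiff h.hasCompactSupport k).abs
  have hj := (integrable_partialD h.contDiff h.hasCompactSupport j).abs
  have hkj := (integrable_partialD (contDiff_partialD h.contDiff j)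
    (hasCompactSupport_partialD h.hasCompactSupport j) k).abs.const_mul ρ
  have hsum : Integrable fun x => |partialD j θ x| + ρ * |partialD k (partialD j θ) x| :=
    hj.add hkj
  calc ∫ x, |partialD k (partialD j fun w => (w m - c m) * θ w) x|
      ≤ ∫ x, (|partialD k θ x| + (|partialD j θ x| + ρ * |partialD k (partialD j θ) x|)) :=
        integral_mono_of_nonneg (ae_of_all _ fun _ => abs_nonneg _) (hk.add hsum)
          (ae_of_all _ (h.abs_partialD_partialD_coord_sub_mul_le hB k j m))
    _ = (∫ x, |partialD k θ x|) +
          ((∫ x, |partialD j θ x|) + ρ * ∫ x, |partialD k (partialD j θ) x|) := by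
        rw [integral_add hk hsum, integral_add hj hkj, integral_const_mul]
    _ ≤ A / ρ + (A / ρ + ρ * (A / ρ ^ 2)) := by
        gcongr
        exacts [h.l1_partialD_bound k, h.l1_partialD_bound j, h.l1_partialD_partialD_bound k j]
    _ = 3 * A / ρ := by
        field_simp
        ring

lemma abs_partialD_coord_sub_mul_le (h : IsBumpOfSize B ρ A θ) (hB : B ⊆ Metric.closedBall c ρ)
    (hρ : 0 < ρ) (j m : Fin n) (x : EuclideanSpace ℝ (Fin n)) :
    |partialD j (fun w => (w m - c m) * θ w) x| ≤ 3 * A / ρ ^ n :=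
  calc |partialD j (fun w => (w m - c m) * θ w) x| ≤ |θ x| + ρ * |partialD j θ x| :=
        _root_.abs_partialD_coord_sub_mul_le (h.contDiff.differentiable (by simp))
          (h.tsupport_subset.trans hB) j m x
    _ ≤ A / ρ ^ n + ρ * (A / ρ ^ (n + 1)) := by
        gcongr
        exacts [h.linfty_bound x, h.linfty_partialD_bound j x]
    _ = 2 * A / ρ ^ n := by
        field_simp
        ring
    _ ≤ 3 * A / ρ ^ n := by
        have := h.nonneg
        gcongr
        norm_num

lemma isMeanZeroBump_partialD_coord_sub_mul (h : IsBumpOfSize B ρ A θ)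
    (hB : B ⊆ Metric.closedBall c ρ) (hρ : 0 < ρ) (j m : Fin n) :
    IsMeanZeroBump c ρ (n * (3 * A)) (partialD j fun w => (w m - c m) * θ w) :=
  _root_.isMeanZeroBump_partialD (contDiff_coord_sub_mul h.contDiff m _)
    (hasCompactSupport_coord_sub_mul h.hasCompactSupport m _)
    ((tsupport_mul_subset_right (f := fun w : EuclideanSpace ℝ (Fin n) => w m - c m)).trans
      (h.tsupport_subset.trans hB)) hρ.le
    (h.integral_abs_partialD_coord_sub_mul_le hB hρ j m)
    (fun k => h.integral_abs_partialD_partialD_coord_sub_mul_le hB hρ k j m)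
    (h.abs_partialD_coord_sub_mul_le hB hρ j m)

end IsBumpOfSize

/-- A majorant of the constants `K_α` with `|α| ≤ 2`. -/
noncomputable def bumpConst (K : List (Fin n) → ℝ) : ℝ :=
  1 + |K []| + ∑ k, |K [k]| + ∑ k, ∑ l, |K [k, l]|

lemma bumpConst_pos (K : List (Fin n) → ℝ) : 0 < bumpConst K := by
  unfold bumpConst
  positivity

lemma le_bumpConst (K : List (Fin n) → ℝ) {J : List (Fin n)} (hJ : J.length ≤ 2) :
    K J ≤ bumpConst K := by
  have h0 : 0 ≤ |K []| := abs_nonneg _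
  have h1 : 0 ≤ ∑ k, |K [k]| := by positivity
  have h2 (k : Fin n) : 0 ≤ ∑ l, |K [k, l]| := by positivity
  have h2' : 0 ≤ ∑ k, ∑ l, |K [k, l]| := Finset.sum_nonneg fun k _ => h2 k
  refine (le_abs_self (K J)).trans ?_
  unfold bumpConst
  match J with
  | [] => linarith
  | [k] =>
    have := Finset.single_le_sum (f := fun k => |K [k]|) (fun _ _ => abs_nonneg _)
      (Finset.mem_univ k)
    linarith
  | [k, l] =>
    have hl := Finset.single_le_sum (f := fun l => |K [k, l]|) (fun _ _ => abs_nonneg _)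
      (Finset.mem_univ l)
    have hk := Finset.single_le_sum (f := fun k => ∑ l, |K [k, l]|) (fun k _ => h2 k)
      (Finset.mem_univ k)
    linarith

lemma IsScaledBump.isBumpOfSize {K : List (Fin n) → ℝ} {B : Set (EuclideanSpace ℝ (Fin n))}
    {θ : EuclideanSpace ℝ (Fin n) → ℝ} (h : IsScaledBump K B θ) :
    IsBumpOfSize B (Metric.diam B) (bumpConst K) θ := by
  have hl1 (J : List (Fin n)) (hJ : J.length ≤ 2) :
      ∫ x, |iteratedPartialD J θ x| ≤ bumpConst K / Metric.diam B ^ J.length :=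
    (h.l1_bound J).trans (div_le_div_of_nonneg_right (le_bumpConst K hJ)
      (pow_nonneg Metric.diam_nonneg _))
  have hlinfty (J : List (Fin n)) (hJ : J.length ≤ 2) (x : EuclideanSpace ℝ (Fin n)) :
      |iteratedPartialD J θ x| ≤ bumpConst K / Metric.diam B ^ (n + J.length) :=
    (h.linfty_bound J x).trans (div_le_div_of_nonneg_right (le_bumpConst K hJ)
      (pow_nonneg Metric.diam_nonneg _))
  exact ⟨h.contDiff, h.hasCompactSupport, h.tsupport_subset,
    by simpa [iteratedPartialD] using hl1 [] (by simp),
    fun j => by simpa [iteratedPartialD] using hl1 [j] (by simp),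
    fun k j => by simpa [iteratedPartialD] using hl1 [k, j] (by simp),
    by simpa [iteratedPartialD] using hlinfty [] (by simp),
    fun j => by simpa [iteratedPartialD] using hlinfty [j] (by simp)⟩

end Bumps

section Convergence

section Majorant

open Module

variable {E : Type*} [NormedAddCommGroup E] [InnerProductSpace ℝ E] [FiniteDimensional ℝ E]
  [MeasurableSpace E] [BorelSpace E]

variable (E) in
/-- The measure `ds dy` on `(0, 1) × E`, over which `reducedPoincare` integrates. -/
noncomputable abbrev stripMeasure : Measure (ℝ × E) :=
  (volume.restrict (Set.Ioo (0 : ℝ) 1)).prod volume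

lemma ae_stripMeasure_fst_mem_Ioo : ∀ᵐ p ∂stripMeasure E, p.1 ∈ Set.Ioo (0 : ℝ) 1 :=
  Measure.quasiMeasurePreserving_fst.ae (ae_restrict_mem measurableSet_Ioo)

lemma lintegral_stripMeasure_snd {g : E → ℝ≥0∞} (hg : Measurable g) :
    ∫⁻ p, g p.2 ∂stripMeasure E = ∫⁻ y, g y := by
  rw [lintegral_prod (fun p : ℝ × E => g p.2) (hg.comp measurable_snd).aemeasurable]
  simp

/-- The integral `∫_0^1 ∫ |θ(w)| |F(y)| dy ds / (1 - s)^d` with `w = segEnd x s y` and `d = dim E`.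
For `x ∈ Ω` it bounds the double integral that defines `reducedPoincare`, up to the factor
`diam Ω`. -/
noncomputable def segMajorant (θ F : E → ℝ) (x : E) : ℝ≥0∞ :=
  ∫⁻ p, segKernel θ p.1 x p.2 * ‖F p.2‖ₑ ∂stripMeasure E

variable {θ F φ : E → ℝ} {Ω : Set E} {M : ℝ}

lemma measurable_segMajorant (hθ : Measurable θ) (hF : Measurable F) :
    Measurable (segMajorant θ F) :=
  ((measurable_segKernel hθ).mul
    (hF.comp (measurable_snd.comp measurable_snd)).enorm).lintegral_prod_right'

lemma lintegral_stripMeasure_segKernel (hθ : Measurable θ) (x : E) :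
    ∫⁻ p, segKernel θ p.1 x p.2 ∂stripMeasure E = ∫⁻ w, ‖θ w‖ₑ := by
  have hm : Measurable fun p : ℝ × E => segKernel θ p.1 x p.2 :=
    (measurable_segKernel hθ).comp measurable_prodMk_left
  calc ∫⁻ p, segKernel θ p.1 x p.2 ∂stripMeasure E
      = ∫⁻ s in Set.Ioo (0 : ℝ) 1, ∫⁻ y, segKernel θ s x y := lintegral_prod _ hm.aemeasurable
    _ = ∫⁻ _ in Set.Ioo (0 : ℝ) 1, ∫⁻ w, ‖θ w‖ₑ :=
        setLIntegral_congr_fun measurableSet_Ioo fun s hs => lintegral_segKernel_right θ hs.2 x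
    _ = ∫⁻ w, ‖θ w‖ₑ := by simp

lemma setLIntegral_segKernel_left_le_uniform (hM : ∀ w, |θ w| ≤ M) (Ω : Set E) {s : ℝ}
    (h0 : 0 < s) (h1 : s < 1) (y : E) :
    ∫⁻ x in Ω, segKernel θ s x y ≤
      ENNReal.ofReal (2 ^ finrank ℝ E) * (ENNReal.ofReal M * volume Ω + ∫⁻ w, ‖θ w‖ₑ) := by
  rcases le_total s (1 / 2) with h | h
  · calc ∫⁻ x in Ω, segKernel θ s x y
        ≤ ENNReal.ofReal M * ENNReal.ofReal ((1 - s)⁻¹ ^ finrank ℝ E) * volume Ω := by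
          simpa only [one_div, inv_pow] using setLIntegral_segKernel_left_le hM Ω s y
      _ = ENNReal.ofReal ((1 - s)⁻¹ ^ finrank ℝ E) * (ENNReal.ofReal M * volume Ω) := by ring
      _ ≤ _ := by
          have : 0 < 1 - s := by linarith
          gcongr
          · rw [inv_le_comm₀ this two_pos]
            linarith
          · exact le_self_add
  · calc ∫⁻ x in Ω, segKernel θ s x y ≤ ∫⁻ x, segKernel θ s x y := setLIntegral_le_lintegral _ _
      _ = ENNReal.ofReal (s⁻¹ ^ finrank ℝ E) * ∫⁻ w, ‖θ w‖ₑ := lintegral_segKernel_left θ h0 h1 y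
      _ ≤ _ := by
          gcongr
          · rw [inv_le_comm₀ h0 two_pos]
            linarith
          · exact le_add_self

lemma lintegral_sq_segMajorant_lt_top (hθ : Measurable θ) (hθi : Integrable θ)
    (hM : ∀ w, |θ w| ≤ M) (hΩ : volume Ω ≠ ⊤) (hF : Measurable F) (hF2 : MemLp F 2 volume) :
    ∫⁻ x in Ω, segMajorant θ F x ^ 2 < ⊤ := by
  have hθfin : ∫⁻ w, ‖θ w‖ₑ ≠ ⊤ := hθi.2.ne
  have hFfin : ∫⁻ p, ‖F p.2‖ₑ ^ 2 ∂stripMeasure E ≠ ⊤ := by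
    rw [lintegral_stripMeasure_snd (g := fun y => ‖F y‖ₑ ^ 2) (hF.enorm.pow_const 2)]
    have h := hF2.2
    rw [eLpNorm_two_eq_lintegral_enorm_sq] at h
    exact ((ENNReal.rpow_lt_top_iff_of_pos (by norm_num)).1 h).ne
  refine (lintegral_sq_lintegral_mul_le_of_schur (ν := stripMeasure E)
    (k := fun x p => segKernel θ p.1 x p.2) (F := fun p => ‖F p.2‖ₑ) (measurable_segKernel hθ)
    (hF.comp measurable_snd).enorm
    (ae_of_all _ fun x => (lintegral_stripMeasure_segKernel hθ x).le)
    (ae_stripMeasure_fst_mem_Ioo.mono fun p hp =>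
      setLIntegral_segKernel_left_le_uniform hM Ω hp.1 hp.2 p.2)).trans_lt ?_
  finiteness

lemma ae_segMajorant_lt_top (hθ : Measurable θ) (hθi : Integrable θ) (hM : ∀ w, |θ w| ≤ M)
    (hΩ : volume Ω ≠ ⊤) (hF : Measurable F) (hF2 : MemLp F 2 volume) :
    ∀ᵐ x ∂volume.restrict Ω, segMajorant θ F x < ⊤ := by
  filter_upwards [ae_lt_top ((measurable_segMajorant hθ hF).pow_const 2)
    (lintegral_sq_segMajorant_lt_top hθ hθi hM hΩ hF hF2).ne] with x hx
  exact (ENNReal.pow_lt_top_iff.1 hx).resolve_right two_ne_zero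

lemma lintegral_mul_segMajorant_lt_top (hθ : Measurable θ) (hθi : Integrable θ)
    (hM : ∀ w, |θ w| ≤ M) (hΩ : volume Ω ≠ ⊤) (hF : Measurable F) (hF2 : MemLp F 2 volume)
    (hφ : Measurable φ) (hφ2 : MemLp φ 2 (volume.restrict Ω)) :
    ∫⁻ x in Ω, ‖φ x‖ₑ * segMajorant θ F x < ⊤ := by
  have h := lintegral_mul_mul_le_rpow_mul_rpow (μ := volume.restrict Ω) (k := fun _ => 1)
    aemeasurable_const hφ.enorm.aemeasurable (measurable_segMajorant hθ hF).aemeasurable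
  simp only [one_mul, ← eLpNorm_two_eq_lintegral_enorm_sq] at h
  exact h.trans_lt (ENNReal.mul_lt_top hφ2.2 (ENNReal.rpow_lt_top_of_nonneg (by norm_num)
    (lintegral_sq_segMajorant_lt_top hθ hθi hM hΩ hF hF2).ne))

end Majorant

variable {n ℓ : ℕ} {m : Fin n} {θ F φ : EuclideanSpace ℝ (Fin n) → ℝ}
  {Ω : Set (EuclideanSpace ℝ (Fin n))} {M : ℝ}

/-- The integrand of the double integral defining `reducedPoincare`, as a function of
`p = (s, y)`. -/
noncomputable def reducedPoincareIntegrand (ℓ : ℕ) (m : Fin n)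
    (θ F : EuclideanSpace ℝ (Fin n) → ℝ) (x : EuclideanSpace ℝ (Fin n))
    (p : ℝ × EuclideanSpace ℝ (Fin n)) : ℝ :=
  p.1 ^ (ℓ - 1) * poincareIntegrand m θ F x p.1 p.2 * (1 / (1 - p.1) ^ n)

lemma coord_sub_div_eq_coord_sub_segEnd (m : Fin n) (x : EuclideanSpace ℝ (Fin n)) {s : ℝ}
    (hs : s < 1) (y : EuclideanSpace ℝ (Fin n)) :
    (x m - y m) / (1 - s) = x m - segEnd x s y m := by
  have h : 1 - s ≠ 0 := by linarith
  simp only [segEnd, PiLp.add_apply, PiLp.smul_apply, PiLp.sub_apply, smul_eq_mul]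
  field_simp
  ring

lemma enorm_reducedPoincareIntegrand_le (hΩ : Bornology.IsBounded Ω)
    (hθ : Function.support θ ⊆ Ω) {x : EuclideanSpace ℝ (Fin n)} (hx : x ∈ Ω)
    {p : ℝ × EuclideanSpace ℝ (Fin n)} (h0 : 0 < p.1) (h1 : p.1 < 1) :
    ‖reducedPoincareIntegrand ℓ m θ F x p‖ₑ ≤
      ENNReal.ofReal (Metric.diam Ω) * (segKernel θ p.1 x p.2 * ‖F p.2‖ₑ) := by
  obtain ⟨s, y⟩ := p
  simp only at h0 h1 ⊢
  have : 0 < 1 - s := by linarith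
  have hfactor : reducedPoincareIntegrand ℓ m θ F x (s, y) =
      (s ^ (ℓ - 1) * (x m - segEnd x s y m)) * (θ (segEnd x s y) * (1 / (1 - s) ^ n) * F y) := by
    rw [← coord_sub_div_eq_coord_sub_segEnd m x h1]
    unfold reducedPoincareIntegrand poincareIntegrand segEnd
    ring
  by_cases hw : θ (segEnd x s y) = 0
  · simp [hfactor, hw]
  have hcoord : |s ^ (ℓ - 1) * (x m - segEnd x s y m)| ≤ Metric.diam Ω := by
    rw [abs_mul, abs_of_nonneg (by positivity)]
    calc s ^ (ℓ - 1) * |x m - segEnd x s y m| ≤ |x m - segEnd x s y m| :=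
          mul_le_of_le_one_left (abs_nonneg _) (pow_le_one₀ h0.le h1.le)
      _ ≤ dist x (segEnd x s y) := by
          rw [dist_eq_norm]
          exact abs_coord_sub_le _ _ m
      _ ≤ Metric.diam Ω := Metric.dist_le_diam_of_mem hΩ hx (hθ hw)
  rw [hfactor, enorm_mul, enorm_mul (_ * _) (F y), enorm_mul (θ _), segKernel,
    finrank_euclideanSpace_fin, Real.enorm_of_nonneg (show 0 ≤ 1 / (1 - s) ^ n by positivity),
    Real.enorm_eq_ofReal_abs]
  gcongr

lemma measurable_reducedPoincareIntegrand (hθ : Measurable θ) (hF : Measurable F) :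
    Measurable fun q : EuclideanSpace ℝ (Fin n) × ℝ × EuclideanSpace ℝ (Fin n) =>
      reducedPoincareIntegrand ℓ m θ F q.1 q.2 := by
  have : Measurable fun q : EuclideanSpace ℝ (Fin n) × ℝ × EuclideanSpace ℝ (Fin n) =>
      θ (q.1 + (1 - q.2.1)⁻¹ • (q.2.2 - q.1)) := hθ.comp measurable_segEnd
  unfold reducedPoincareIntegrand poincareIntegrand
  fun_prop

lemma lintegral_enorm_reducedPoincareIntegrand_le (hΩ : Bornology.IsBounded Ω)
    (hθ : Function.support θ ⊆ Ω) {x : EuclideanSpace ℝ (Fin n)} (hx : x ∈ Ω) :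
    ∫⁻ p, ‖reducedPoincareIntegrand ℓ m θ F x p‖ₑ ∂stripMeasure (EuclideanSpace ℝ (Fin n)) ≤
      ENNReal.ofReal (Metric.diam Ω) * segMajorant θ F x := by
  rw [segMajorant, ← lintegral_const_mul' _ _ ENNReal.ofReal_ne_top]
  exact lintegral_mono_ae (ae_stripMeasure_fst_mem_Ioo.mono fun p hp =>
    enorm_reducedPoincareIntegrand_le hΩ hθ hx hp.1 hp.2)

lemma ae_integrable_reducedPoincareIntegrand (hΩm : MeasurableSet Ω)
    (hΩ : Bornology.IsBounded Ω) (hθΩ : Function.support θ ⊆ Ω) (hθ : Measurable θ)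
    (hθi : Integrable θ) (hM : ∀ w, |θ w| ≤ M) (hF : Measurable F) (hF2 : MemLp F 2 volume) :
    ∀ᵐ x ∂volume.restrict Ω, Integrable (reducedPoincareIntegrand ℓ m θ F x)
      (stripMeasure (EuclideanSpace ℝ (Fin n))) := by
  filter_upwards [ae_segMajorant_lt_top hθ hθi hM hΩ.measure_lt_top.ne hF hF2,
    ae_restrict_mem hΩm] with x hx hxΩ
  exact ⟨((measurable_reducedPoincareIntegrand hθ hF).comp
      measurable_prodMk_left).aestronglyMeasurable,
    (lintegral_enorm_reducedPoincareIntegrand_le hΩ hθΩ hxΩ).trans_lt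
      (ENNReal.mul_lt_top ENNReal.ofReal_lt_top hx)⟩

lemma reducedPoincare_eq_integral {x : EuclideanSpace ℝ (Fin n)}
    (h : Integrable (reducedPoincareIntegrand ℓ m θ F x)
      (stripMeasure (EuclideanSpace ℝ (Fin n)))) :
    reducedPoincare ℓ m θ F x =
      ∫ p, reducedPoincareIntegrand ℓ m θ F x p ∂stripMeasure (EuclideanSpace ℝ (Fin n)) := by
  rw [integral_prod _ h, reducedPoincare]
  simp only [reducedPoincareIntegrand, integral_mul_const, integral_const_mul]

lemma memLp_reducedPoincare (hΩm : MeasurableSet Ω) (hΩ : Bornology.IsBounded Ω)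
    (hθΩ : Function.support θ ⊆ Ω) (hθ : Measurable θ) (hθi : Integrable θ)
    (hM : ∀ w, |θ w| ≤ M) (hF : Measurable F) (hF2 : MemLp F 2 volume) :
    MemLp (reducedPoincare ℓ m θ F) 2 (volume.restrict Ω) := by
  have hmeas : StronglyMeasurable fun x => ∫ p, reducedPoincareIntegrand ℓ m θ F x p
      ∂stripMeasure (EuclideanSpace ℝ (Fin n)) :=
    (measurable_reducedPoincareIntegrand hθ hF).stronglyMeasurable.integral_prod_right
  refine MemLp.ae_eq ((ae_integrable_reducedPoincareIntegrand hΩm hΩ hθΩ hθ hθi hM hF hF2).mono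
    fun x hx => (reducedPoincare_eq_integral hx).symm) ⟨hmeas.aestronglyMeasurable, ?_⟩
  rw [eLpNorm_two_eq_lintegral_enorm_sq]
  refine ENNReal.rpow_lt_top_of_nonneg (by norm_num) (ne_of_lt ?_)
  calc ∫⁻ x in Ω, ‖∫ p, reducedPoincareIntegrand ℓ m θ F x p
        ∂stripMeasure (EuclideanSpace ℝ (Fin n))‖ₑ ^ 2
      ≤ ∫⁻ x in Ω, ENNReal.ofReal (Metric.diam Ω) ^ 2 * segMajorant θ F x ^ 2 := by
        refine setLIntegral_mono' hΩm fun x hx => ?_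
        rw [← mul_pow]
        gcongr
        exact (enorm_integral_le_lintegral_enorm _).trans
          (lintegral_enorm_reducedPoincareIntegrand_le hΩ hθΩ hx)
    _ = ENNReal.ofReal (Metric.diam Ω) ^ 2 * ∫⁻ x in Ω, segMajorant θ F x ^ 2 :=
        lintegral_const_mul' _ _ (by finiteness)
    _ < ⊤ := ENNReal.mul_lt_top (by finiteness)
        (lintegral_sq_segMajorant_lt_top hθ hθi hM hΩ.measure_lt_top.ne hF hF2)

lemma integrable_reducedPoincareIntegrand_mul (hΩm : MeasurableSet Ω)
    (hΩ : Bornology.IsBounded Ω) (hθΩ : Function.support θ ⊆ Ω) (hθ : Measurable θ)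
    (hθi : Integrable θ) (hM : ∀ w, |θ w| ≤ M) (hF : Measurable F) (hF2 : MemLp F 2 volume)
    (hφ : Measurable φ) (hφ2 : MemLp φ 2 (volume.restrict Ω)) :
    Integrable (fun q : EuclideanSpace ℝ (Fin n) × ℝ × EuclideanSpace ℝ (Fin n) =>
      reducedPoincareIntegrand ℓ m θ F q.1 q.2 * φ q.1)
      ((volume.restrict Ω).prod (stripMeasure (EuclideanSpace ℝ (Fin n)))) := by
  have hmeas : Measurable fun q : EuclideanSpace ℝ (Fin n) × ℝ × EuclideanSpace ℝ (Fin n) =>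
      reducedPoincareIntegrand ℓ m θ F q.1 q.2 * φ q.1 :=
    (measurable_reducedPoincareIntegrand hθ hF).mul (hφ.comp measurable_fst)
  refine ⟨hmeas.aestronglyMeasurable, ?_⟩
  rw [hasFiniteIntegral_iff_enorm, lintegral_prod _ hmeas.enorm.aemeasurable]
  calc ∫⁻ x in Ω, ∫⁻ p, ‖reducedPoincareIntegrand ℓ m θ F x p * φ x‖ₑ
        ∂stripMeasure (EuclideanSpace ℝ (Fin n))
      ≤ ∫⁻ x in Ω, ENNReal.ofReal (Metric.diam Ω) * (‖φ x‖ₑ * segMajorant θ F x) := by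
        refine setLIntegral_mono' hΩm fun x hx => ?_
        simp only [enorm_mul]
        rw [lintegral_mul_const' _ _ enorm_ne_top, mul_comm, mul_left_comm]
        gcongr
        exact lintegral_enorm_reducedPoincareIntegrand_le hΩ hθΩ hx
    _ = ENNReal.ofReal (Metric.diam Ω) * ∫⁻ x in Ω, ‖φ x‖ₑ * segMajorant θ F x :=
        lintegral_const_mul' _ _ ENNReal.ofReal_ne_top
    _ < ⊤ := ENNReal.mul_lt_top ENNReal.ofReal_lt_top
        (lintegral_mul_segMajorant_lt_top hθ hθi hM hΩ.measure_lt_top.ne hF hF2 hφ hφ2)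

end Convergence

section Congruence

variable {n ℓ : ℕ} {m : Fin n} {θ f F : EuclideanSpace ℝ (Fin n) → ℝ}
  {Ω B : Set (EuclideanSpace ℝ (Fin n))} {x : EuclideanSpace ℝ (Fin n)}

lemma IsStarShapedWrt.smul_add_smul_mem (h : IsStarShapedWrt Ω B)
    {w : EuclideanSpace ℝ (Fin n)} (hx : x ∈ Ω) (hw : w ∈ B) {s : ℝ} (h0 : 0 ≤ s) (h1 : s ≤ 1) :
    s • x + (1 - s) • w ∈ Ω :=
  h.2 x hx (convex_convexHull ℝ (B ∪ {x}) (subset_convexHull ℝ _ (Or.inr rfl))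
    (subset_convexHull ℝ _ (Or.inl hw)) h0 (sub_nonneg.2 h1) (by ring))

lemma IsStarShapedWrt.poincareIntegrand_congr (h : IsStarShapedWrt Ω B)
    (hθ : Function.support θ ⊆ B) (hx : x ∈ Ω) {s : ℝ} (h0 : 0 ≤ s) (h1 : s < 1)
    {y : EuclideanSpace ℝ (Fin n)} (hfF : y ∈ Ω → f y = F y) :
    poincareIntegrand m θ f x s y = poincareIntegrand m θ F x s y := by
  by_cases hw : θ (x + (1 - s)⁻¹ • (y - x)) = 0
  · simp [poincareIntegrand, hw]
  · have hy := h.smul_add_smul_mem hx (hθ hw) h0 h1.le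
    rw [← segEnd, smul_add_smul_segEnd h1] at hy
    rw [poincareIntegrand, poincareIntegrand, hfF hy]

lemma IsStarShapedWrt.reducedPoincare_congr_ae (h : IsStarShapedWrt Ω B)
    (hθ : Function.support θ ⊆ B) (hx : x ∈ Ω) (hfF : ∀ᵐ y, y ∈ Ω → f y = F y) :
    reducedPoincare ℓ m θ f x = reducedPoincare ℓ m θ F x := by
  refine setIntegral_congr_fun measurableSet_Ioo fun s hs => ?_
  have hinner : ∫ y, poincareIntegrand m θ f x s y = ∫ y, poincareIntegrand m θ F x s y :=
    integral_congr_ae (hfF.mono fun y hy => h.poincareIntegrand_congr hθ hx hs.1.le hs.2 hy)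
  simp only [hinner]

lemma IsStarShapedWrt.reducedPoincareConverges_congr_ae (h : IsStarShapedWrt Ω B)
    (hθ : Function.support θ ⊆ B) (hx : x ∈ Ω) (hfF : ∀ᵐ y, y ∈ Ω → f y = F y) :
    ReducedPoincareConverges ℓ m θ f x ↔ ReducedPoincareConverges ℓ m θ F x := by
  refine integrable_congr ?_
  filter_upwards [ae_stripMeasure_fst_mem_Ioo, Measure.quasiMeasurePreserving_snd.ae hfF]
    with p hp hfFp
  simp only [h.poincareIntegrand_congr hθ hx hp.1.le hp.2 hfFp]

end Congruence

section WeakFormulation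

variable {n : ℕ} {θ F φ : EuclideanSpace ℝ (Fin n) → ℝ} {s : ℝ}

lemma hasFDerivAt_segEnd (hs : s < 1) (x y : EuclideanSpace ℝ (Fin n)) :
    HasFDerivAt (fun x : EuclideanSpace ℝ (Fin n) => segEnd x s y)
      ((-(s * (1 - s)⁻¹)) • ContinuousLinearMap.id ℝ (EuclideanSpace ℝ (Fin n))) x := by
  simp_rw [segEnd_eq_add_smul_left hs]
  exact ((hasFDerivAt_id x).const_smul (-(s * (1 - s)⁻¹))).const_add _

lemma contDiff_segEnd (s : ℝ) (y : EuclideanSpace ℝ (Fin n)) :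
    ContDiff ℝ ∞ fun x : EuclideanSpace ℝ (Fin n) => segEnd x s y := by
  unfold segEnd
  fun_prop

/-- The kernel `θ(w) (x_m - y_m) / (1 - s)` of the operator, with `w = segEnd x s y`, as a function
of `x`. -/
noncomputable def poincareKernel (m : Fin n) (θ : EuclideanSpace ℝ (Fin n) → ℝ) (s : ℝ)
    (y x : EuclideanSpace ℝ (Fin n)) : ℝ :=
  θ (segEnd x s y) * ((x m - y m) / (1 - s))

lemma contDiff_poincareKernel (hθ : ContDiff ℝ ∞ θ) (m : Fin n) (s : ℝ)
    (y : EuclideanSpace ℝ (Fin n)) : ContDiff ℝ ∞ (poincareKernel m θ s y) :=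
  (hθ.comp (contDiff_segEnd s y)).mul
    (((EuclideanSpace.proj m : EuclideanSpace ℝ (Fin n) →L[ℝ] ℝ).contDiff.sub
      contDiff_const).div_const _)

/- Writing `(x_m - y_m) / (1 - s) = (x_m - a) - (w_m - a)`, the singular factor `s / (1 - s)` of
`∂_j` only multiplies derivatives of test functions, which have mean zero. -/
lemma partialD_poincareKernel (hθ : Differentiable ℝ θ) (j m : Fin n) (a : ℝ) (hs : s < 1)
    (x y : EuclideanSpace ℝ (Fin n)) :
    partialD j (poincareKernel m θ s y) x =
      (if j = m then 1 else 0) * θ (segEnd x s y) + s / (1 - s) *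
        (partialD j (fun w => (w m - a) * θ w) (segEnd x s y) -
          (x m - a) * partialD j θ (segEnd x s y)) := by
  have hne : 1 - s ≠ 0 := by linarith
  have hbump : HasFDerivAt (fun x => θ (segEnd x s y)) _ x :=
    (hθ _).hasFDerivAt.comp x (hasFDerivAt_segEnd hs x y)
  have hcoord : HasFDerivAt (fun x : EuclideanSpace ℝ (Fin n) => (x m - y m) / (1 - s)) _ x :=
    ((EuclideanSpace.proj m : EuclideanSpace ℝ (Fin n) →L[ℝ] ℝ).hasFDerivAt.sub_const
      (y m)).mul_const (1 - s)⁻¹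
  have hproduct : HasFDerivAt (poincareKernel m θ s y) _ x := hbump.mul hcoord
  have hproj : (EuclideanSpace.proj m : EuclideanSpace ℝ (Fin n) →L[ℝ] ℝ)
      (EuclideanSpace.single j 1) = if j = m then 1 else 0 := by
    rcases eq_or_ne j m with rfl | hjm
    · simp
    · simp [hjm, hjm.symm]
  rw [partialD, hproduct.fderiv, partialD_coord_sub_mul hθ, partialD]
  simp only [add_apply, smul_apply, ContinuousLinearMap.comp_apply, ContinuousLinearMap.id_apply,
    map_smul, smul_eq_mul, coord_sub_div_eq_coord_sub_segEnd m x hs y, hproj]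
  split_ifs <;> field_simp <;> ring

lemma integral_poincareKernel_mul_partialD (hθ : ContDiff ℝ ∞ θ) (hφ : ContDiff ℝ ∞ φ)
    (hφc : HasCompactSupport φ) (j m : Fin n) (s : ℝ) (y : EuclideanSpace ℝ (Fin n)) :
    ∫ x, poincareKernel m θ s y x * partialD j φ x =
      -∫ x, partialD j (poincareKernel m θ s y) x * φ x := by
  have hk := contDiff_poincareKernel hθ m s y
  refine integral_mul_fderiv_eq_neg_fderiv_mul_of_integrable (𝕜 := ℝ) (μ := volume) ?_ ?_ ?_
    (fun x _ => hk.differentiable (by simp) x) (fun x _ => hφ.differentiable (by simp) x)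
  · exact ((contDiff_partialD hk j).continuous.mul hφ.continuous).integrable_of_hasCompactSupport
      hφc.mul_left
  · exact (hk.continuous.mul (contDiff_partialD hφ j).continuous).integrable_of_hasCompactSupport
      (hasCompactSupport_partialD hφc j).mul_left
  · exact (hk.continuous.mul hφ.continuous).integrable_of_hasCompactSupport hφc.mul_left

/-- The value at `s` of the bilinear form that represents the weak derivative `∂_j`: the sum of the
forms belonging to the three terms of `partialD_poincareKernel`. -/
noncomputable def derivForm (j m : Fin n) (a : ℝ) (θ F φ : EuclideanSpace ℝ (Fin n) → ℝ) (s : ℝ) :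
    ℝ :=
  (if j = m then 1 else 0) * segForm s θ F φ + s / (1 - s) *
    (segForm s (partialD j fun w => (w m - a) * θ w) F φ -
      segForm s (partialD j θ) F fun x => (x m - a) * φ x)

lemma integrable_segForm_integrand_of_contDiff (hθ : ContDiff ℝ ∞ θ) (hθc : HasCompactSupport θ)
    (hF : Measurable F) (hF2 : MemLp F 2 volume) (hφ : ContDiff ℝ ∞ φ) (hφc : HasCompactSupport φ)
    (h0 : 0 < s) (h1 : s < 1) :
    Integrable fun p : EuclideanSpace ℝ (Fin n) × EuclideanSpace ℝ (Fin n) =>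
      φ p.1 * (θ (segEnd p.1 s p.2) * F p.2 * (1 / (1 - s) ^ n)) := by
  simpa only [finrank_euclideanSpace_fin] using
    integrable_segForm_integrand hθ.continuous.measurable
      (hθ.continuous.integrable_of_hasCompactSupport hθc) hF hF2 hφ.continuous.measurable
      (hφ.continuous.memLp_of_hasCompactSupport hφc) h0 h1

lemma integrable_and_derivForm_eq_integral (hθ : ContDiff ℝ ∞ θ) (hθc : HasCompactSupport θ)
    (hF : Measurable F) (hF2 : MemLp F 2 volume) (hφ : ContDiff ℝ ∞ φ) (hφc : HasCompactSupport φ)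
    (j m : Fin n) (a : ℝ) (h0 : 0 < s) (h1 : s < 1) :
    Integrable (fun p : EuclideanSpace ℝ (Fin n) × EuclideanSpace ℝ (Fin n) =>
      F p.2 * (1 / (1 - s) ^ n) * (partialD j (poincareKernel m θ s p.2) p.1 * φ p.1)) ∧
    derivForm j m a θ F φ s =
      ∫ p : EuclideanSpace ℝ (Fin n) × EuclideanSpace ℝ (Fin n),
        F p.2 * (1 / (1 - s) ^ n) * (partialD j (poincareKernel m θ s p.2) p.1 * φ p.1) := by
  have hregular := integrable_segForm_integrand_of_contDiff hθ hθc hF hF2 hφ hφc h0 h1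
  have hcoordBump := integrable_segForm_integrand_of_contDiff
    (contDiff_partialD (contDiff_coord_sub_mul hθ m a) j)
    (hasCompactSupport_partialD (hasCompactSupport_coord_sub_mul hθc m a) j) hF hF2 hφ hφc h0 h1
  have hcoordTest := integrable_segForm_integrand_of_contDiff (contDiff_partialD hθ j)
    (hasCompactSupport_partialD hθc j) hF hF2 (contDiff_coord_sub_mul hφ m a)
    (hasCompactSupport_coord_sub_mul hφc m a) h0 h1
  have hexpand (p : EuclideanSpace ℝ (Fin n) × EuclideanSpace ℝ (Fin n)) :
      F p.2 * (1 / (1 - s) ^ n) * (partialD j (poincareKernel m θ s p.2) p.1 * φ p.1) =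
        (if j = m then 1 else 0) * (φ p.1 * (θ (segEnd p.1 s p.2) * F p.2 * (1 / (1 - s) ^ n))) +
        s / (1 - s) *
          (φ p.1 * (partialD j (fun w => (w m - a) * θ w) (segEnd p.1 s p.2) * F p.2 *
              (1 / (1 - s) ^ n)) -
            (p.1 m - a) * φ p.1 * (partialD j θ (segEnd p.1 s p.2) * F p.2 *
              (1 / (1 - s) ^ n))) := by
    rw [partialD_poincareKernel (hθ.differentiable (by simp)) j m a h1]
    ring
  simp only [hexpand]
  refine ⟨(hregular.const_mul _).add ((hcoordBump.sub hcoordTest).const_mul _), ?_⟩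
  refine Eq.trans ?_
    (integral_add (hregular.const_mul _) ((hcoordBump.sub hcoordTest).const_mul _)).symm
  simp only [integral_const_mul, integral_sub' hcoordBump hcoordTest, derivForm, segForm,
    finrank_euclideanSpace_fin]

lemma derivForm_eq_neg_integral (hθ : ContDiff ℝ ∞ θ) (hθc : HasCompactSupport θ)
    (hF : Measurable F) (hF2 : MemLp F 2 volume) (hφ : ContDiff ℝ ∞ φ) (hφc : HasCompactSupport φ)
    (j m : Fin n) (a : ℝ) (h0 : 0 < s) (h1 : s < 1) :
    derivForm j m a θ F φ s =
      -∫ y, F y * (1 / (1 - s) ^ n) * ∫ x, poincareKernel m θ s y x * partialD j φ x := by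
  obtain ⟨hint, heq⟩ := integrable_and_derivForm_eq_integral hθ hθc hF hF2 hφ hφc j m a h0 h1
  rw [heq, Measure.volume_eq_prod, integral_prod_symm _ hint, ← integral_neg]
  simp only [integral_const_mul, integral_poincareKernel_mul_partialD hθ hφ hφc, mul_neg, neg_neg]

variable {ℓ : ℕ} {m : Fin n} {Ω : Set (EuclideanSpace ℝ (Fin n))}

lemma integral_reducedPoincareIntegrand_mul_partialD (hθ : ContDiff ℝ ∞ θ)
    (hθc : HasCompactSupport θ) (hF : Measurable F) (hF2 : MemLp F 2 volume) (hφ : ContDiff ℝ ∞ φ)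
    (hφc : HasCompactSupport φ) (hφΩ : tsupport φ ⊆ Ω) (j : Fin n) (a : ℝ) (h0 : 0 < s)
    (h1 : s < 1) :
    ∫ y, ∫ x in Ω, reducedPoincareIntegrand ℓ m θ F x (s, y) * partialD j φ x =
      -(s ^ (ℓ - 1) * derivForm j m a θ F φ s) := by
  rw [derivForm_eq_neg_integral hθ hθc hF hF2 hφ hφc j m a h0 h1, mul_neg, neg_neg,
    ← integral_const_mul]
  refine integral_congr_ae (ae_of_all _ fun y => ?_)
  simp only
  rw [← integral_const_mul, ← integral_const_mul, setIntegral_eq_integral_of_forall_compl_eq_zero]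
  · refine integral_congr_ae (ae_of_all _ fun x => ?_)
    simp only [reducedPoincareIntegrand, poincareIntegrand, poincareKernel, segEnd]
    ring
  · intro x hx
    rw [Function.notMem_support.1 fun h => hx (hφΩ (support_partialD_subset φ j h)), mul_zero]

lemma integral_reducedPoincare_mul_partialD (hΩm : MeasurableSet Ω) (hΩ : Bornology.IsBounded Ω)
    (hθΩ : Function.support θ ⊆ Ω) (hθ : ContDiff ℝ ∞ θ) (hθc : HasCompactSupport θ)
    (hF : Measurable F) (hF2 : MemLp F 2 volume) (hφ : ContDiff ℝ ∞ φ) (hφc : HasCompactSupport φ)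
    (hφΩ : tsupport φ ⊆ Ω) (j : Fin n) (a : ℝ) :
    ∫ x in Ω, reducedPoincare ℓ m θ F x * partialD j φ x =
      -∫ s in Set.Ioo (0 : ℝ) 1, s ^ (ℓ - 1) * derivForm j m a θ F φ s := by
  have hθm : Measurable θ := hθ.continuous.measurable
  have hθi : Integrable θ := hθ.continuous.integrable_of_hasCompactSupport hθc
  obtain ⟨M, hM⟩ := hθc.exists_bound_of_continuous hθ.continuous
  have hφj := (contDiff_partialD hφ j).continuous
  have hint := integrable_reducedPoincareIntegrand_mul (ℓ := ℓ) (m := m) hΩm hΩ hθΩ hθm hθi hM hF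
    hF2 hφj.measurable (hφj.memLp_of_hasCompactSupport (hasCompactSupport_partialD hφc j))
  calc ∫ x in Ω, reducedPoincare ℓ m θ F x * partialD j φ x
      = ∫ x in Ω, ∫ p, reducedPoincareIntegrand ℓ m θ F x p * partialD j φ x
          ∂stripMeasure (EuclideanSpace ℝ (Fin n)) := by
        refine integral_congr_ae ?_
        filter_upwards [ae_integrable_reducedPoincareIntegrand (ℓ := ℓ) (m := m) hΩm hΩ hθΩ hθm
          hθi hM hF hF2] with x hx
        rw [reducedPoincare_eq_integral hx, integral_mul_const]
    _ = ∫ p, (∫ x in Ω, reducedPoincareIntegrand ℓ m θ F x p * partialD j φ x)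
          ∂stripMeasure (EuclideanSpace ℝ (Fin n)) := integral_integral_swap hint
    _ = ∫ s in Set.Ioo (0 : ℝ) 1, ∫ y, ∫ x in Ω,
          reducedPoincareIntegrand ℓ m θ F x (s, y) * partialD j φ x :=
        integral_prod _ hint.integral_prod_right
    _ = ∫ s in Set.Ioo (0 : ℝ) 1, -(s ^ (ℓ - 1) * derivForm j m a θ F φ s) :=
        setIntegral_congr_fun measurableSet_Ioo fun s hs =>
          integral_reducedPoincareIntegrand_mul_partialD hθ hθc hF hF2 hφ hφc hφΩ j a hs.1 hs.2
    _ = _ := integral_neg _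

end WeakFormulation

lemma add_add_le_five_mul_mul_div {a A ρ R : ℝ} (ha : 1 ≤ a) (hA : 0 ≤ A) (hρ : 0 < ρ)
    (hρR : ρ ≤ R) : A + (a * (3 * A) + a * (A / ρ) * R) ≤ 5 * a * A * (R / ρ) := by
  have hAa : A ≤ a * A := le_mul_of_one_le_left hA ha
  have haR : a * A ≤ a * A * (R / ρ) :=
    le_mul_of_one_le_right (by positivity) ((one_le_div hρ).2 hρR)
  calc A + (a * (3 * A) + a * (A / ρ) * R) = A + 3 * (a * A) + a * A * (R / ρ) := by ring
    _ ≤ 5 * a * A * (R / ρ) := by linarith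

section Estimates

variable {n ℓ : ℕ} {θ F φ : EuclideanSpace ℝ (Fin n) → ℝ} {A R V l ρ : ℝ}
  {c : EuclideanSpace ℝ (Fin n)} {B Ω : Set (EuclideanSpace ℝ (Fin n))}

lemma eLpNorm_coord_sub_mul_le (hφΩ : Function.support φ ⊆ Ω) (hR : ∀ x ∈ Ω, ‖x - c‖ ≤ R)
    (m : Fin n) :
    eLpNorm (fun x => (x m - c m) * φ x) 2 volume ≤ ENNReal.ofReal R * eLpNorm φ 2 volume := by
  refine eLpNorm_le_mul_eLpNorm_of_ae_le_mul (ae_of_all _ fun x => ?_) 2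
  by_cases hx : x ∈ Ω
  · rw [norm_mul, Real.norm_eq_abs]
    gcongr
    exact (abs_coord_sub_le x c m).trans (hR x hx)
  · simp [Function.notMem_support.1 fun h => hx (hφΩ h)]

lemma mul_enorm_derivForm_le (ℓ : ℕ) (j m : Fin n) (a : ℝ)
    (θ F φ : EuclideanSpace ℝ (Fin n) → ℝ) {s : ℝ} (h0 : 0 < s) (h1 : s < 1) :
    ENNReal.ofReal (s ^ (ℓ - 1)) * ‖derivForm j m a θ F φ s‖ₑ ≤
      ENNReal.ofReal (s ^ (ℓ - 1)) * ‖segForm s θ F φ‖ₑ +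
        (ENNReal.ofReal (s ^ (ℓ - 1) * (s / (1 - s))) *
            ‖segForm s (partialD j fun w => (w m - a) * θ w) F φ‖ₑ +
          ENNReal.ofReal (s ^ (ℓ - 1) * (s / (1 - s))) *
            ‖segForm s (partialD j θ) F fun x => (x m - a) * φ x‖ₑ) := by
  have : 0 < 1 - s := sub_pos.2 h1
  rw [derivForm, ENNReal.ofReal_mul (by positivity), mul_assoc, mul_assoc, ← mul_add, ← mul_add,
    ← mul_add]
  gcongr
  refine (enorm_add_le _ _).trans (add_le_add ?_ ?_)
  · split_ifs <;> simp
  · rw [enorm_mul, Real.enorm_of_nonneg (by positivity)]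
    gcongr
    exact enorm_sub_le

namespace IsBumpOfSize

lemma lintegral_pow_mul_enorm_segForm_le (hθ : IsBumpOfSize B ρ A θ) (hρ : 0 < ρ) (hV : 1 ≤ V)
    (hΩ : volume Ω ≤ ENNReal.ofReal (V * ρ ^ n)) (hF : Measurable F) (hφ : Measurable φ)
    (hφΩ : Function.support φ ⊆ Ω) (h0 : 0 ≤ l) (h1 : l ≤ 1) :
    ∫⁻ s in Set.Ioo (0 : ℝ) 1, ENNReal.ofReal (s ^ (ℓ - 1)) * ‖segForm s θ F φ‖ₑ ≤
      ENNReal.ofReal A * (2 ^ n * interpolationIntegral n ℓ V l) *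
        (eLpNorm F 2 volume * eLpNorm φ 2 volume) := by
  have hfinrank : Module.finrank ℝ (EuclideanSpace ℝ (Fin n)) = n := finrank_euclideanSpace_fin
  simpa only [hfinrank] using _root_.lintegral_pow_mul_enorm_segForm_le ℓ hθ.measurable hF hφ hφΩ hρ
    hV (by rwa [hfinrank]) hθ.nonneg hθ.lintegral_enorm_le
    (by simpa only [hfinrank] using hθ.linfty_bound) h0 h1

lemma lintegral_singular_mul_enorm_segForm_partialD_coord_sub_mul_le (hθ : IsBumpOfSize B ρ A θ)
    (hB : B ⊆ Metric.closedBall c ρ) (hρ : 0 < ρ) (hV : 1 ≤ V)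
    (hΩ : volume Ω ≤ ENNReal.ofReal (V * ρ ^ n)) (hF : Measurable F) (hF2 : MemLp F 2 volume)
    (hφ : ContDiff ℝ ∞ φ) (hφc : HasCompactSupport φ) (hφΩ : Function.support φ ⊆ Ω)
    (h0 : 0 ≤ l) (h1 : l ≤ 1) (j m : Fin n) :
    ∫⁻ s in Set.Ioo (0 : ℝ) 1, ENNReal.ofReal (s ^ (ℓ - 1) * (s / (1 - s))) *
        ‖segForm s (partialD j fun w => (w m - c m) * θ w) F φ‖ₑ ≤
      ENNReal.ofReal (n * (3 * A)) *
        (2 ^ n * interpolationIntegral n ℓ V l + ENNReal.ofReal (nearConst n)) *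
          (eLpNorm F 2 volume * eLpNorm φ 2 volume) := by
  have hfinrank : Module.finrank ℝ (EuclideanSpace ℝ (Fin n)) = n := finrank_euclideanSpace_fin
  have hbump := hθ.isMeanZeroBump_partialD_coord_sub_mul hB hρ j m
  simpa only [hfinrank] using hbump.lintegral_singular_mul_enorm_segForm_le ℓ hF hF2 hφ hφc hφΩ hρ
    hV (by rwa [hfinrank]) h0 h1

lemma lintegral_singular_mul_enorm_segForm_partialD_le (hθ : IsBumpOfSize B ρ A θ)
    (hB : B ⊆ Metric.closedBall c ρ) (hρ : 0 < ρ) (hR : ∀ x ∈ Ω, ‖x - c‖ ≤ R) (hV : 1 ≤ V)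
    (hΩ : volume Ω ≤ ENNReal.ofReal (V * ρ ^ n)) (hF : Measurable F) (hF2 : MemLp F 2 volume)
    (hφ : ContDiff ℝ ∞ φ) (hφc : HasCompactSupport φ) (hφΩ : Function.support φ ⊆ Ω)
    (h0 : 0 ≤ l) (h1 : l ≤ 1) (j m : Fin n) :
    ∫⁻ s in Set.Ioo (0 : ℝ) 1, ENNReal.ofReal (s ^ (ℓ - 1) * (s / (1 - s))) *
        ‖segForm s (partialD j θ) F fun x => (x m - c m) * φ x‖ₑ ≤
      ENNReal.ofReal (n * (A / ρ) * R) *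
        (2 ^ n * interpolationIntegral n ℓ V l + ENNReal.ofReal (nearConst n)) *
          (eLpNorm F 2 volume * eLpNorm φ 2 volume) := by
  have hfinrank : Module.finrank ℝ (EuclideanSpace ℝ (Fin n)) = n := finrank_euclideanSpace_fin
  have hA : 0 ≤ A := hθ.nonneg
  have hform := (hθ.isMeanZeroBump_partialD hB hρ j).lintegral_singular_mul_enorm_segForm_le ℓ hF
    hF2 (contDiff_coord_sub_mul hφ m (c m)) (hasCompactSupport_coord_sub_mul hφc m (c m))
    ((Function.support_mul_subset_right _ _).trans hφΩ) hρ hV (by rwa [hfinrank]) h0 h1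
  grw [hform, eLpNorm_coord_sub_mul_le hφΩ hR m]
  rw [hfinrank, ENNReal.ofReal_mul (q := R) (by positivity)]
  exact (by ring : _ = _).le

lemma lintegral_pow_mul_enorm_derivForm_le (hθ : IsBumpOfSize B ρ A θ)
    (hB : B ⊆ Metric.closedBall c ρ) (hρ : 0 < ρ) (hρR : ρ ≤ R) (hR : ∀ x ∈ Ω, ‖x - c‖ ≤ R)
    (hV : 1 ≤ V) (hΩ : volume Ω ≤ ENNReal.ofReal (V * ρ ^ n)) (hF : Measurable F)
    (hF2 : MemLp F 2 volume) (hφ : ContDiff ℝ ∞ φ) (hφc : HasCompactSupport φ)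
    (hφΩ : Function.support φ ⊆ Ω) (h0 : 0 ≤ l) (h1 : l ≤ 1) (j m : Fin n) :
    ∫⁻ s in Set.Ioo (0 : ℝ) 1, ENNReal.ofReal (s ^ (ℓ - 1)) *
        ‖derivForm j m (c m) θ F φ s‖ₑ ≤
      ENNReal.ofReal (5 * n * A * (R / ρ)) *
        (2 ^ n * interpolationIntegral n ℓ V l + ENNReal.ofReal (nearConst n)) *
          (eLpNorm F 2 volume * eLpNorm φ 2 volume) := by
  have hA : 0 ≤ A := hθ.nonneg
  have hR0 : 0 ≤ R := hρ.le.trans hρR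
  have hmeas {ψ η : EuclideanSpace ℝ (Fin n) → ℝ} (hψ : ContDiff ℝ ∞ ψ) (hη : ContDiff ℝ ∞ η) :
      Measurable fun s => ‖segForm s ψ F η‖ₑ :=
    (measurable_segForm hψ.continuous.measurable hF hη.continuous.measurable).enorm
  have := hmeas hθ.contDiff hφ
  have := hmeas (contDiff_partialD (contDiff_coord_sub_mul hθ.contDiff m (c m)) j) hφ
  set q := 2 ^ n * interpolationIntegral n ℓ V l + ENNReal.ofReal (nearConst n)
  set N := eLpNorm F 2 volume * eLpNorm φ 2 volume
  calc ∫⁻ s in Set.Ioo (0 : ℝ) 1, ENNReal.ofReal (s ^ (ℓ - 1)) * ‖derivForm j m (c m) θ F φ s‖ₑ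
      ≤ ENNReal.ofReal A * (2 ^ n * interpolationIntegral n ℓ V l) * N +
          (ENNReal.ofReal (n * (3 * A)) * q * N + ENNReal.ofReal (n * (A / ρ) * R) * q * N) := by
        grw [setLIntegral_mono' measurableSet_Ioo fun s hs =>
          mul_enorm_derivForm_le ℓ j m (c m) θ F φ hs.1 hs.2]
        rw [lintegral_add_left (by fun_prop), lintegral_add_left (by fun_prop)]
        gcongr
        · exact hθ.lintegral_pow_mul_enorm_segForm_le hρ hV hΩ hF hφ.continuous.measurable hφΩ h0 h1
        · exact hθ.lintegral_singular_mul_enorm_segForm_partialD_coord_sub_mul_le hB hρ hV hΩ hF hF2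
            hφ hφc hφΩ h0 h1 j m
        · exact hθ.lintegral_singular_mul_enorm_segForm_partialD_le hB hρ hR hV hΩ hF hF2 hφ hφc hφΩ
            h0 h1 j m
    _ ≤ ENNReal.ofReal A * q * N +
          (ENNReal.ofReal (n * (3 * A)) * q * N + ENNReal.ofReal (n * (A / ρ) * R) * q * N) := by
        gcongr
        exact le_self_add
    _ = ENNReal.ofReal (A + (n * (3 * A) + n * (A / ρ) * R)) * q * N := by
        rw [ENNReal.ofReal_add hA (by positivity), ENNReal.ofReal_add (by positivity)
          (by positivity)]
        ring
    _ ≤ ENNReal.ofReal (5 * n * A * (R / ρ)) * q * N := by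
        gcongr
        exact add_add_le_five_mul_mul_div (mod_cast j.pos) hA hρ hρR

lemma abs_integral_reducedPoincare_mul_partialD_le (hθ : IsBumpOfSize B ρ A θ) (hBΩ : B ⊆ Ω)
    (hB : B ⊆ Metric.closedBall c ρ) (hΩm : MeasurableSet Ω) (hΩb : Bornology.IsBounded Ω)
    (hρ : 0 < ρ) (hρR : ρ ≤ R) (hR : ∀ x ∈ Ω, ‖x - c‖ ≤ R)
    (hV : 1 ≤ V) (hΩ : volume Ω ≤ ENNReal.ofReal (V * ρ ^ n)) (hF : Measurable F)
    (hF2 : MemLp F 2 volume) (hφ : ContDiff ℝ ∞ φ) (hφc : HasCompactSupport φ)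
    (hφΩ : tsupport φ ⊆ Ω) (h0 : 0 ≤ l) (h1 : l ≤ 1) {Q : ℝ} (hQ0 : 0 ≤ Q)
    (hQ : interpolationIntegral n ℓ V l ≤ ENNReal.ofReal Q) (j m : Fin n) :
    |∫ x in Ω, reducedPoincare ℓ m θ F x * partialD j φ x| ≤
      5 * n * A * (R / ρ) * (2 ^ n * Q + nearConst n) *
        ((eLpNorm F 2 volume).toReal * (eLpNorm φ 2 volume).toReal) := by
  have hA : 0 ≤ A := hθ.nonneg
  have hR0 : 0 ≤ R := hρ.le.trans hρR
  have hnear := nearConst_pos n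
  have hφ2 : MemLp φ 2 volume := hφ.continuous.memLp_of_hasCompactSupport hφc
  have hweak := integral_reducedPoincare_mul_partialD (ℓ := ℓ) (m := m) hΩm hΩb
    ((subset_tsupport θ).trans (hθ.tsupport_subset.trans hBΩ)) hθ.contDiff hθ.hasCompactSupport hF
    hF2 hφ hφc hφΩ j (c m)
  have henorm : ‖∫ x in Ω, reducedPoincare ℓ m θ F x * partialD j φ x‖ₑ ≤
      ENNReal.ofReal (5 * n * A * (R / ρ) * (2 ^ n * Q + nearConst n)) *
        (eLpNorm F 2 volume * eLpNorm φ 2 volume) := by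
    calc ‖∫ x in Ω, reducedPoincare ℓ m θ F x * partialD j φ x‖ₑ
        ≤ ∫⁻ s in Set.Ioo (0 : ℝ) 1, ‖s ^ (ℓ - 1) * derivForm j m (c m) θ F φ s‖ₑ := by
          rw [hweak, enorm_neg]
          exact enorm_integral_le_lintegral_enorm _
      _ = ∫⁻ s in Set.Ioo (0 : ℝ) 1,
            ENNReal.ofReal (s ^ (ℓ - 1)) * ‖derivForm j m (c m) θ F φ s‖ₑ :=
          setLIntegral_congr_fun measurableSet_Ioo fun s hs => by
            rw [enorm_mul, Real.enorm_of_nonneg (pow_nonneg hs.1.le _)]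
      _ ≤ _ := hθ.lintegral_pow_mul_enorm_derivForm_le hB hρ hρR hR hV hΩ hF hF2 hφ hφc
            ((subset_tsupport φ).trans hφΩ) h0 h1 j m
      _ ≤ _ := by
          grw [hQ]
          rw [ENNReal.ofReal_mul (q := 2 ^ n * Q + nearConst n) (by positivity),
            ENNReal.ofReal_add (by positivity) hnear.le,
            ENNReal.ofReal_mul (q := Q) (by positivity), ENNReal.ofReal_pow zero_le_two,
            ENNReal.ofReal_ofNat]
  have hfin : eLpNorm F 2 volume * eLpNorm φ 2 volume ≠ ⊤ :=
    ENNReal.mul_ne_top hF2.2.ne hφ2.2.ne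
  have hreal := ENNReal.toReal_mono (ENNReal.mul_ne_top ENNReal.ofReal_ne_top hfin) henorm
  rwa [toReal_enorm, Real.norm_eq_abs, ENNReal.toReal_mul, ENNReal.toReal_ofReal (by positivity),
    ENNReal.toReal_mul] at hreal

end IsBumpOfSize

end Estimates

section Main

variable {n ℓ : ℕ} {m : Fin n} {θ f : EuclideanSpace ℝ (Fin n) → ℝ}
  {c : EuclideanSpace ℝ (Fin n)} {r A : ℝ} {B Ω : Set (EuclideanSpace ℝ (Fin n))}

lemma volume_ball_le_ofReal_two_mul_pow (c : EuclideanSpace ℝ (Fin n)) (hr : 0 < r) :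
    volume (Metric.ball c r) ≤ ENNReal.ofReal ((2 * r) ^ n) := by
  have hsub : Metric.ball c r ⊆ WithLp.ofLp ⁻¹' Metric.ball c.ofLp r := fun x hx => by
    rw [Set.mem_preimage, Metric.mem_ball, dist_pi_lt_iff hr]
    exact fun i => (PiLp.dist_apply_le x c i).trans_lt hx
  calc volume (Metric.ball c r) ≤ volume (WithLp.ofLp ⁻¹' Metric.ball c.ofLp r) :=
        measure_mono hsub
    _ = volume (Metric.ball c.ofLp r) :=
        (PiLp.volume_preserving_ofLp (Fin n)).measure_preimage
          measurableSet_ball.nullMeasurableSet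
    _ = ENNReal.ofReal ((2 * r) ^ n) := by rw [Real.volume_pi_ball _ hr, Fintype.card_fin]

lemma one_le_volume_div_volume_ball (hr : 0 < r) (hB : Metric.ball c r ⊆ Ω)
    (hΩ : Bornology.IsBounded Ω) :
    1 ≤ (volume Ω).toReal / (volume (Metric.ball c r)).toReal := by
  rw [one_le_div (ENNReal.toReal_pos (Metric.measure_ball_pos volume c hr).ne'
    Metric.isBounded_ball.measure_lt_top.ne)]
  exact ENNReal.toReal_mono hΩ.measure_lt_top.ne (measure_mono hB)

lemma volume_le_volume_div_volume_ball_mul (c : EuclideanSpace ℝ (Fin n)) (hr : 0 < r)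
    (hΩ : Bornology.IsBounded Ω) :
    volume Ω ≤ ENNReal.ofReal
      ((volume Ω).toReal / (volume (Metric.ball c r)).toReal * (2 * r) ^ n) := by
  have hball : 0 < (volume (Metric.ball c r)).toReal :=
    ENNReal.toReal_pos (Metric.measure_ball_pos volume c hr).ne'
      Metric.isBounded_ball.measure_lt_top.ne
  rw [← ENNReal.ofReal_toReal hΩ.measure_lt_top.ne, ENNReal.toReal_ofReal ENNReal.toReal_nonneg]
  refine ENNReal.ofReal_le_ofReal ?_
  calc (volume Ω).toReal
      = (volume Ω).toReal / (volume (Metric.ball c r)).toReal *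
          (volume (Metric.ball c r)).toReal := (div_mul_cancel₀ _ hball.ne').symm
    _ ≤ _ := by
        gcongr
        exact ENNReal.toReal_le_of_le_ofReal (by positivity)
          (volume_ball_le_ofReal_two_mul_pow c hr)

lemma exists_measurable_memLp_eq_on (hΩ : MeasurableSet Ω) (hf : MemLp f 2 (volume.restrict Ω)) :
    ∃ F, Measurable F ∧ MemLp F 2 volume ∧ (∀ᵐ y, y ∈ Ω → f y = F y) ∧
      (eLpNorm F 2 volume).toReal = l2Norm Ω f := by
  have hmk : ∀ᵐ y, y ∈ Ω → f y = hf.1.mk f y := (ae_restrict_iff' hΩ).1 hf.1.ae_eq_mk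
  refine ⟨Ω.indicator (hf.1.mk f), hf.1.stronglyMeasurable_mk.measurable.indicator hΩ,
    (memLp_indicator_iff_restrict hΩ).2 (hf.ae_eq hf.1.ae_eq_mk), ?_, ?_⟩
  · filter_upwards [hmk] with y hy hyΩ
    rw [Set.indicator_of_mem hyΩ, hy hyΩ]
  · rw [eLpNorm_indicator_eq_eLpNorm_restrict hΩ]
    exact congrArg ENNReal.toReal (eLpNorm_congr_ae hf.1.ae_eq_mk.symm)

lemma IsBumpOfSize.ae_reducedPoincareConverges_and_memLp {ρ : ℝ} (hθ : IsBumpOfSize B ρ A θ)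
    (hstar : IsStarShapedWrt Ω B) (hΩm : MeasurableSet Ω) (hΩ : Bornology.IsBounded Ω)
    (hf : MemLp f 2 (volume.restrict Ω)) :
    (∀ᵐ x ∂(volume.restrict Ω), ReducedPoincareConverges ℓ m θ f x) ∧
      MemLp (reducedPoincare ℓ m θ f) 2 (volume.restrict Ω) := by
  obtain ⟨F, hF, hF2, hfF, -⟩ := exists_measurable_memLp_eq_on hΩm hf
  have hθB : Function.support θ ⊆ B := (subset_tsupport θ).trans hθ.tsupport_subset
  constructor
  · filter_upwards [ae_integrable_reducedPoincareIntegrand hΩm hΩ (hθB.trans hstar.1)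
      hθ.measurable hθ.integrable hθ.linfty_bound hF hF2, ae_restrict_mem hΩm] with x hx hxΩ
    exact (hstar.reducedPoincareConverges_congr_ae hθB hxΩ hfF).2 hx
  · refine (memLp_reducedPoincare (ℓ := ℓ) (m := m) hΩm hΩ (hθB.trans hstar.1) hθ.measurable
      hθ.integrable hθ.linfty_bound hF hF2).ae_eq ?_
    filter_upwards [ae_restrict_mem hΩm] with x hx
    exact (hstar.reducedPoincare_congr_ae hθB hx hfF).symm

lemma IsBumpOfSize.abs_integral_reducedPoincare_mul_partialD_le_l2Norm {ρ R V l Q : ℝ}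
    {φ : EuclideanSpace ℝ (Fin n) → ℝ} (hθ : IsBumpOfSize B ρ A θ) (hstar : IsStarShapedWrt Ω B)
    (hB : B ⊆ Metric.closedBall c ρ) (hΩm : MeasurableSet Ω) (hΩb : Bornology.IsBounded Ω)
    (hρ : 0 < ρ) (hρR : ρ ≤ R) (hR : ∀ x ∈ Ω, ‖x - c‖ ≤ R) (hV : 1 ≤ V)
    (hΩ : volume Ω ≤ ENNReal.ofReal (V * ρ ^ n)) (hf : MemLp f 2 (volume.restrict Ω))
    (hφ : ContDiff ℝ ∞ φ) (hφc : HasCompactSupport φ) (hφΩ : tsupport φ ⊆ Ω) (h0 : 0 ≤ l)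
    (h1 : l ≤ 1) (hQ0 : 0 ≤ Q) (hQ : interpolationIntegral n ℓ V l ≤ ENNReal.ofReal Q)
    (j m : Fin n) :
    |∫ x in Ω, reducedPoincare ℓ m θ f x * partialD j φ x| ≤
      5 * n * A * (R / ρ) * (2 ^ n * Q + nearConst n) * (l2Norm Ω f * l2Norm Ω φ) := by
  obtain ⟨F, hF, hF2, hfF, hFnorm⟩ := exists_measurable_memLp_eq_on hΩm hf
  have hφnorm : (eLpNorm φ 2 volume).toReal = l2Norm Ω φ :=
    congrArg ENNReal.toReal
      (eLpNorm_restrict_eq_of_support_subset ((subset_tsupport φ).trans hφΩ)).symm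
  have hcongr : ∫ x in Ω, reducedPoincare ℓ m θ f x * partialD j φ x =
      ∫ x in Ω, reducedPoincare ℓ m θ F x * partialD j φ x :=
    setIntegral_congr_fun hΩm fun x hx => congrArg (· * partialD j φ x)
      (hstar.reducedPoincare_congr_ae ((subset_tsupport θ).trans hθ.tsupport_subset) hx hfF)
  rw [hcongr, ← hFnorm, ← hφnorm]
  exact hθ.abs_integral_reducedPoincare_mul_partialD_le hstar.1 hB hΩm hΩb hρ hρR hR hV hΩ hF hF2
    hφ hφc hφΩ h0 h1 hQ0 hQ j m

lemma exists_abs_integral_reducedPoincare_mul_partialD_le (n : ℕ) (hℓ : 1 ≤ ℓ) :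
    ∃ C, 0 < C ∧ ∀ {Ω : Set (EuclideanSpace ℝ (Fin n))} {c : EuclideanSpace ℝ (Fin n)}
      {θ f φ : EuclideanSpace ℝ (Fin n) → ℝ} {r A : ℝ} (j m : Fin n), MeasurableSet Ω →
      Bornology.IsBounded Ω → 0 < r → IsStarShapedWrt Ω (Metric.ball c r) →
      IsBumpOfSize (Metric.ball c r) (Metric.diam (Metric.ball c r)) A θ →
      MemLp f 2 (volume.restrict Ω) →
      ContDiff ℝ ∞ φ → HasCompactSupport φ → tsupport φ ⊆ Ω →
      |∫ x in Ω, reducedPoincare ℓ m θ f x * partialD j φ x| ≤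
        C * A * (Metric.diam Ω / Metric.diam (Metric.ball c r)) *
          kappa n ℓ ((volume Ω).toReal / (volume (Metric.ball c r)).toReal) * l2Norm Ω f *
          l2Norm Ω φ := by
  obtain ⟨C, hC, hCκ⟩ := exists_interpolationIntegral_le_kappa n hℓ
  have hnear := nearConst_pos n
  refine ⟨(5 * n + 1) * (2 ^ n * C + nearConst n), by positivity, ?_⟩
  intro Ω c θ f φ r A j m hΩm hΩ hr hstar hθ hf hφ hφc hφΩ
  have : Nonempty (Fin n) := ⟨j⟩
  have hA : 0 ≤ A := hθ.nonneg
  have hdiam : Metric.diam (Metric.ball c r) = 2 * r := Metric.diam_ball_eq c hr.le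
  have hdiam_le : 2 * r ≤ Metric.diam Ω := hdiam ▸ Metric.diam_mono hstar.1 hΩ
  have hdist (x) (hx : x ∈ Ω) : ‖x - c‖ ≤ Metric.diam Ω :=
    (dist_eq_norm x c).symm.trans_le
      (Metric.dist_le_diam_of_mem hΩ hx (hstar.1 (Metric.mem_ball_self hr)))
  have hV := one_le_volume_div_volume_ball hr hstar.1 hΩ
  have hΩvol := volume_le_volume_div_volume_ball_mul c hr hΩ
  rw [hdiam] at hθ ⊢
  set V := (volume Ω).toReal / (volume (Metric.ball c r)).toReal
  have hκ := one_le_kappa n ℓ hV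
  obtain ⟨l, h0, h1, hl⟩ := hCκ V hV
  have hconst : 5 * n * A * (Metric.diam Ω / (2 * r)) *
        (2 ^ n * (C * kappa n ℓ V) + nearConst n) ≤
      (5 * n + 1) * A * (Metric.diam Ω / (2 * r)) *
        (2 ^ n * (C * kappa n ℓ V) + nearConst n * kappa n ℓ V) := by
    gcongr
    · linarith
    · exact le_mul_of_one_le_right hnear.le hκ
  calc |∫ x in Ω, reducedPoincare ℓ m θ f x * partialD j φ x|
      ≤ 5 * n * A * (Metric.diam Ω / (2 * r)) * (2 ^ n * (C * kappa n ℓ V) + nearConst n) *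
          (l2Norm Ω f * l2Norm Ω φ) :=
        hθ.abs_integral_reducedPoincare_mul_partialD_le_l2Norm hstar
          (Metric.ball_subset_closedBall.trans (Metric.closedBall_subset_closedBall (by linarith)))
          hΩm hΩ (by positivity) hdiam_le hdist hV hΩvol hf hφ hφc hφΩ h0 h1 (by positivity) hl j m
    _ ≤ _ := mul_le_mul_of_nonneg_right hconst
        (mul_nonneg ENNReal.toReal_nonneg ENNReal.toReal_nonneg)
    _ = _ := by ring

theorem mainTheorem7_general (n ℓ : ℕ) (hℓ : 1 ≤ ℓ) :
    ∃ C : ℝ, 0 < C ∧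
      ∀ (Ω : Set (EuclideanSpace ℝ (Fin n))) (c : EuclideanSpace ℝ (Fin n)) (r A : ℝ)
        (θ f : EuclideanSpace ℝ (Fin n) → ℝ) (m : Fin n),
        IsOpen Ω → Bornology.IsBounded Ω → 0 < r →
        IsStarShapedWrt Ω (Metric.ball c r) →
        IsBumpOfSize (Metric.ball c r) (Metric.diam (Metric.ball c r)) A θ →
        MemLp f 2 (volume.restrict Ω) →
        (∀ᵐ x ∂(volume.restrict Ω), ReducedPoincareConverges ℓ m θ f x) ∧
        ∃ g : Fin n → EuclideanSpace ℝ (Fin n) → ℝ,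
          IsH1WithGradient Ω (reducedPoincare ℓ m θ f) g ∧
          Real.sqrt (∑ j, l2Norm Ω (g j) ^ 2) ≤
            C * A * (Metric.diam Ω / Metric.diam (Metric.ball c r)) *
              kappa n ℓ ((volume Ω).toReal / (volume (Metric.ball c r)).toReal) *
              l2Norm Ω f := by
  obtain ⟨C, hC, hbound⟩ := exists_abs_integral_reducedPoincare_mul_partialD_le n hℓ
  refine ⟨√n * C + C, by positivity, fun Ω c r A θ f m hΩ hΩb hr hstar hθ hf => ?_⟩
  obtain ⟨hconv, hu⟩ := hθ.ae_reducedPoincareConverges_and_memLp hstar hΩ.measurableSet hΩb hf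
  refine ⟨hconv, ?_⟩
  have hA : 0 ≤ A := hθ.nonneg
  have hκ := one_le_kappa n ℓ (one_le_volume_div_volume_ball hr hstar.1 hΩb)
  have hf0 : 0 ≤ l2Norm Ω f := ENNReal.toReal_nonneg
  obtain ⟨g, hg, hgM⟩ := exists_isH1WithGradient hΩb.measure_lt_top.ne hu (by positivity)
    fun j φ => hbound j m hΩ.measurableSet hΩb hr hstar hθ hf φ.2.1 φ.2.2.1 φ.2.2.2
  refine ⟨g, hg, hgM.trans ?_⟩
  rw [← mul_assoc, ← mul_assoc, ← mul_assoc, ← mul_assoc]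
  gcongr
  exact le_add_of_nonneg_right hC.le

end Main

theorem mainTheorem7 (n ℓ : ℕ) (hℓ : 1 ≤ ℓ) (hℓn : ℓ ≤ n) (K : List (Fin n) → ℝ) :
    ∃ C : ℝ, 0 < C ∧
      ∀ (Ω : Set (EuclideanSpace ℝ (Fin n))) (c : EuclideanSpace ℝ (Fin n)) (r : ℝ)
        (θ f : EuclideanSpace ℝ (Fin n) → ℝ) (m : Fin n),
        IsOpen Ω → Bornology.IsBounded Ω → 0 < r →
        IsStarShapedWrt Ω (Metric.ball c r) →
        IsScaledBump K (Metric.ball c r) θ →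
        MemLp f 2 volume → (∀ᵐ y, y ∉ closure Ω → f y = 0) →
        (∀ᵐ x ∂(volume.restrict Ω), ReducedPoincareConverges ℓ m θ f x) ∧
        ∃ g : Fin n → EuclideanSpace ℝ (Fin n) → ℝ,
          IsH1WithGradient Ω (reducedPoincare ℓ m θ f) g ∧
          Real.sqrt (∑ j, l2Norm Ω (g j) ^ 2) ≤
            C * (Metric.diam Ω / Metric.diam (Metric.ball c r)) *
              kappa n ℓ ((volume Ω).toReal / (volume (Metric.ball c r)).toReal) *
              l2Norm Ω f := by
  obtain ⟨C, hC, hbound⟩ := mainTheorem7_general n ℓ hℓ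
  exact ⟨C * bumpConst K, mul_pos hC (bumpConst_pos K), fun Ω c r θ f m hΩ hΩb hr hstar hθ hf _ =>
    hbound Ω c r _ θ f m hΩ hΩb hr hstar hθ.isBumpOfSize (hf.restrict Ω)⟩
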